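/- **Definitions.** Let $V$ be a finite-dimensional real vector space and $\omega_1,\dots,\omega_s\in\bigwedge^2V^*$. For $\alpha\in\bigwedge^*V^*$ let $C(\alpha)$ denote the smallest subspace $W\subset V^*$ such that $\alpha\in\bigwedge^*W$. The forms $\omega_1,\dots,\omega_s$ induce a *polysymplectic structure of rank $n$* on $V$ if (1) the forms $\omega_1^{\wedge i_1}\wedge\cdots\wedge\omega_s^{\wedge i_s}$, for $(i_1,\dots,i_s)\in\mathbb{Z}_{\ge0}^s$ with $i_1+\cdots+i_s=n$, are linearly independent; (2) all the forms $\omega_1^{\wedge i_1}\wedge\cdots\wedge\omega_s^{\wedge i_s}$ with $i_1+\cdots+i_s=n+1$ are $0$; (3) $\dim\big(C(\omega_j)\cap\sum_{k\ne j}C(\omega_k)\big)\le n$ for all $j$. A smooth manifold $X$ of dimension $n(s+1)$ together with closed smooth $2$-forms $\omega_1,\dots,\omega_s$ is a *(non-degenerate) polysymplectic manifold* if $(\omega_1)_q,\dots,(\omega_s)_q$ induce a polysymplectic structure of rank $n$ on $T_qX$ for every $q\in X$, and the distribution $$C^X_q=\{\alpha\in T_q^*X:\ \alpha\wedge(\omega_1^{\wedge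 n})_q=\cdots=\alpha\wedge(\omega_s^{\wedge n})_q=0\}$$ is locally generated by closed smooth $1$-forms. **Theorem (Polysymplectic normal form).** Let $s\ge1$, let $(X,\omega_1,\dots,\omega_s)$ be a (non-degenerate) polysymplectic manifold of dimension $n(s+1)$, and let $p\in X$. Denote the coordinates on $\mathbb{R}^{n(s+1)}$ by $x_i,\,y^j_i$ ($1\le i\le n$, $1\le j\le s$). (a) There are an open neighborhood $\mathcal U\subset X$ of $p$, an open neighborhood $\mathcal V\subset\mathbb{R}^{n(s+1)}$ of $0$ and a smooth diffeomorphism $\Phi:\mathcal U\to\mathcal V$ with $\Phi(p)=0$ such that $$\omega_j=\Phi^*\Big(\sum_{i=1}^n dx_i\wedge dy^j_i\Big)\quad\text{on }\mathcal U,\qquad j=1,\dots,s.$$ (b) Given any $\phi_i,\psi^j_i\in T_p^*X$ ($1\le i\le n$, $1\le j\le s$) such that $(\omega_j)_p=\sum_{i=1}^n\phi_i\wedge\psi^j_i$ for all $j$, the map $\Phi$ in (a) can be chosen so that moreover $d(x_i\circ\Phi)_p=\phi_i$ and $d(y^j_i\circ\Phi)_p=\psi^j_i$ for all $i,j$. 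-/

import Mathlib

open scoped Manifold ContDiff

/-! ### Linear algebra: polysymplectic vector spaces -/

/-- The element of `⋀² V* ⊆ ⋀ V*` corresponding to an alternating bilinear form `Ω` on the
finite-dimensional space `V`, namely `½ ∑ a b, Ω(v_a, v_b) • v_a* ∧ v_b*` for a basis `(v_a)`.
The normalization is the one in which `α ∧ β` corresponds to the alternating form
`(v, w) ↦ α v * β w - α w * β v`, see `twoFormToExterior_eq_ι_mul_ι`. -/
noncomputable def twoFormToExterior {V : Type*} [AddCommGroup V] [Module ℝ V]
    [FiniteDimensional ℝ V] (Ω : V [⋀^Fin 2]→ₗ[ℝ] ℝ) :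
    ExteriorAlgebra ℝ (Module.Dual ℝ V) :=
  (1 / 2 : ℝ) • ∑ a, ∑ b, Ω ![Module.finBasis ℝ V a, Module.finBasis ℝ V b] •
    (ExteriorAlgebra.ι ℝ ((Module.finBasis ℝ V).coord a) *
      ExteriorAlgebra.ι ℝ ((Module.finBasis ℝ V).coord b))

theorem twoFormToExterior_eq_ι_mul_ι {V : Type*} [AddCommGroup V] [Module ℝ V]
    [FiniteDimensional ℝ V] (Ω : V [⋀^Fin 2]→ₗ[ℝ] ℝ) (α β : Module.Dual ℝ V)
    (h : ∀ v w, Ω ![v, w] = α v * β w - α w * β v) :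
    twoFormToExterior Ω = ExteriorAlgebra.ι ℝ α * ExteriorAlgebra.ι ℝ β := by
  have key : ∀ γ : Module.Dual ℝ V, ExteriorAlgebra.ι ℝ γ =
      ∑ a, γ (Module.finBasis ℝ V a) • ExteriorAlgebra.ι ℝ ((Module.finBasis ℝ V).coord a) := by
    intro γ
    conv_lhs => rw [← (Module.finBasis ℝ V).sum_dual_apply_smul_coord γ]
    simp only [map_sum, map_smul]
  have e1 : ∀ γ δ : Module.Dual ℝ V, ExteriorAlgebra.ι ℝ γ * ExteriorAlgebra.ι ℝ δ =
      ∑ a, ∑ b, (γ (Module.finBasis ℝ V a) * δ (Module.finBasis ℝ V b)) •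
        (ExteriorAlgebra.ι ℝ ((Module.finBasis ℝ V).coord a) *
          ExteriorAlgebra.ι ℝ ((Module.finBasis ℝ V).coord b)) := by
    intro γ δ
    conv_lhs => rw [key γ, key δ, Finset.sum_mul_sum]
    simp only [smul_mul_smul_comm]
  have e2 : ExteriorAlgebra.ι ℝ β * ExteriorAlgebra.ι ℝ α =
      -(ExteriorAlgebra.ι ℝ α * ExteriorAlgebra.ι ℝ β) :=
    eq_neg_of_add_eq_zero_left (ExteriorAlgebra.ι_add_mul_swap β α)
  have e3 : (∑ a, ∑ b, Ω ![Module.finBasis ℝ V a, Module.finBasis ℝ V b] •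
      (ExteriorAlgebra.ι ℝ ((Module.finBasis ℝ V).coord a) *
        ExteriorAlgebra.ι ℝ ((Module.finBasis ℝ V).coord b))) =
      ExteriorAlgebra.ι ℝ α * ExteriorAlgebra.ι ℝ β -
        ExteriorAlgebra.ι ℝ β * ExteriorAlgebra.ι ℝ α := by
    rw [e1 α β, e1 β α]
    simp only [← Finset.sum_sub_distrib, ← sub_smul]
    refine Finset.sum_congr rfl fun a _ => Finset.sum_congr rfl fun b _ => ?_
    rw [h, mul_comm (β _)]
  rw [twoFormToExterior, e3, e2, sub_neg_eq_add, ← two_smul ℝ, smul_smul]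
  norm_num

/-- `C(α)`: the smallest subspace `W` of `V*` such that `α` lies in `⋀ W`. -/
noncomputable def exteriorSupport {V : Type*} [AddCommGroup V] [Module ℝ V]
    (α : ExteriorAlgebra ℝ (Module.Dual ℝ V)) : Submodule ℝ (Module.Dual ℝ V) :=
  sInf {W | α ∈ (ExteriorAlgebra.map (R := ℝ) (M := ↥W) (N := Module.Dual ℝ V) W.subtype).range}

/-- The product `Ω₁^{h₁} ∧ ⋯ ∧ Ω_s^{h_s}` in the exterior algebra of `V*`. -/
noncomputable def wedgeMonomial {V : Type*} [AddCommGroup V] [Module ℝ V]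
    [FiniteDimensional ℝ V] {s : ℕ} (Ω : Fin s → V [⋀^Fin 2]→ₗ[ℝ] ℝ) (h : Fin s → ℕ) :
    ExteriorAlgebra ℝ (Module.Dual ℝ V) :=
  (List.ofFn fun j => twoFormToExterior (Ω j) ^ h j).prod

/-- The forms `Ω₁, …, Ω_s` induce a polysymplectic structure of rank `n` on `V`. -/
structure IsPolysymplecticSpace {V : Type*} [AddCommGroup V] [Module ℝ V]
    [FiniteDimensional ℝ V] (n : ℕ) {s : ℕ} (Ω : Fin s → V [⋀^Fin 2]→ₗ[ℝ] ℝ) : Prop where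
  independent : LinearIndependent ℝ
    fun h : {h : Fin s → ℕ // ∑ j, h j = n} => wedgeMonomial Ω h.1
  vanishing : ∀ h : Fin s → ℕ, ∑ j, h j = n + 1 → wedgeMonomial Ω h = 0
  finrank_inf_le : ∀ j, Module.finrank ℝ
    ↥(exteriorSupport (twoFormToExterior (Ω j)) ⊓
      ⨆ k : {k : Fin s // k ≠ j}, exteriorSupport (twoFormToExterior (Ω k.1))) ≤ n

/-- The wedge product of two covectors, `(α ∧ β)(v, w) = α v * β w - α w * β v`. -/
noncomputable def covectorWedge {V : Type*} [AddCommGroup V] [Module ℝ V] [TopologicalSpace V]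
    (α β : V →L[ℝ] ℝ) : V [⋀^Fin 2]→L[ℝ] ℝ :=
  ContinuousMultilinearMap.alternatization
    ((ContinuousMultilinearMap.mkPiAlgebra ℝ (Fin 2) ℝ).compContinuousLinearMap ![α, β])

theorem covectorWedge_apply {V : Type*} [AddCommGroup V] [Module ℝ V] [TopologicalSpace V]
    (α β : V →L[ℝ] ℝ) (v w : V) :
    covectorWedge α β ![v, w] = α v * β w - α w * β v := by
  have h : (Finset.univ : Finset (Equiv.Perm (Fin 2))) = {1, Equiv.swap 0 1} := by decide
  rw [covectorWedge, ContinuousMultilinearMap.alternatization_apply_apply, h,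
    Finset.sum_pair (by decide)]
  simp [Fin.prod_univ_two, sub_eq_add_neg]

/-! ### Differential forms on manifolds (without boundary, modelled on `E`) -/

instance instFiniteDimensionalTangentSpaceModel {E : Type*} [NormedAddCommGroup E]
    [NormedSpace ℝ E] [FiniteDimensional ℝ E] {M : Type*} [TopologicalSpace M]
    [ChartedSpace E M] (q : M) : FiniteDimensional ℝ (TangentSpace 𝓘(ℝ, E) q) :=
  inferInstanceAs (FiniteDimensional ℝ E)

/-- Differential forms of degree `k` (no regularity imposed) on a manifold `M` modelled on `E`. -/
abbrev DiffForm (E : Type*) [NormedAddCommGroup E] [NormedSpace ℝ E] (M : Type*)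
    [TopologicalSpace M] [ChartedSpace E M] (k : ℕ) : Type _ :=
  ∀ q : M, TangentSpace 𝓘(ℝ, E) q [⋀^Fin k]→L[ℝ] ℝ

namespace DiffForm

/-- The pullback of a differential form along a map. -/
noncomputable def pullback {E E' : Type*} [NormedAddCommGroup E] [NormedSpace ℝ E]
    [NormedAddCommGroup E'] [NormedSpace ℝ E'] {M M' : Type*} [TopologicalSpace M]
    [ChartedSpace E M] [TopologicalSpace M'] [ChartedSpace E' M'] {k : ℕ}
    (f : M → M') (Ω : DiffForm E' M' k) : DiffForm E M k :=
  fun q => (Ω (f q)).compContinuousLinearMap (mfderiv 𝓘(ℝ, E) 𝓘(ℝ, E') f q)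

/-- The expression of a form in the chart `e`: a form on `E`, meaningful on `e.target`. -/
noncomputable def inChart {E : Type*} [NormedAddCommGroup E] [NormedSpace ℝ E] {M : Type*}
    [TopologicalSpace M] [ChartedSpace E M] {k : ℕ} (Ω : DiffForm E M k)
    (e : OpenPartialHomeomorph M E) : E → E [⋀^Fin k]→L[ℝ] ℝ :=
  fun y => pullback (E := E) (M := E) e.symm Ω y

/-- The form `Ω` is smooth on the open set `U`: its expressions in charts are smooth. -/
def SmoothOn {E : Type*} [NormedAddCommGroup E] [NormedSpace ℝ E] {M : Type*}
    [TopologicalSpace M] [ChartedSpace E M] {k : ℕ} (Ω : DiffForm E M k) (U : Set M) : Prop :=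
  ∀ e ∈ atlas E M, ContDiffOn ℝ ∞ (Ω.inChart e) (e.target ∩ e.symm ⁻¹' U)

/-- The form `Ω`, smooth on the open set `U`, is closed there: `dΩ = 0` on `U`, where `d` is
computed in charts. -/
def ClosedOn {E : Type*} [NormedAddCommGroup E] [NormedSpace ℝ E] {M : Type*}
    [TopologicalSpace M] [ChartedSpace E M] {k : ℕ} (Ω : DiffForm E M k) (U : Set M) : Prop :=
  ∀ e ∈ atlas E M, ∀ y ∈ e.target ∩ e.symm ⁻¹' U, extDeriv (Ω.inChart e) y = 0

/-- The covector at `q` given by a `1`-form. -/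
noncomputable def covectorAt {E : Type*} [NormedAddCommGroup E] [NormedSpace ℝ E] {M : Type*}
    [TopologicalSpace M] [ChartedSpace E M] (θ : DiffForm E M 1) (q : M) :
    Module.Dual ℝ (TangentSpace 𝓘(ℝ, E) q) :=
  (AlternatingMap.ofSubsingleton ℝ (TangentSpace 𝓘(ℝ, E) q) ℝ (0 : Fin 1)).symm
    (θ q).toAlternatingMap

theorem covectorAt_apply {E : Type*} [NormedAddCommGroup E] [NormedSpace ℝ E] {M : Type*}
    [TopologicalSpace M] [ChartedSpace E M] (θ : DiffForm E M 1) (q : M)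
    (v : TangentSpace 𝓘(ℝ, E) q) : θ.covectorAt q v = θ q (fun _ => v) :=
  rfl

end DiffForm

/-! ### Polysymplectic manifolds -/

/-- The subspace `C^M_q = {α ∈ T*_q M : α ∧ Ω₁ⁿ = ⋯ = α ∧ Ω_sⁿ = 0}`. -/
noncomputable def polyDistribution {E : Type*} [NormedAddCommGroup E] [NormedSpace ℝ E]
    [FiniteDimensional ℝ E] {M : Type*} [TopologicalSpace M] [ChartedSpace E M] (n : ℕ) {s : ℕ}
    (Ω : Fin s → DiffForm E M 2) (q : M) : Submodule ℝ (Module.Dual ℝ (TangentSpace 𝓘(ℝ, E) q)) where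
  carrier := {α | ∀ j, ExteriorAlgebra.ι ℝ α *
    twoFormToExterior (Ω j q).toAlternatingMap ^ n = 0}
  add_mem' ha hb j := by rw [map_add, add_mul, ha j, hb j, add_zero]
  zero_mem' j := by rw [map_zero, zero_mul]
  smul_mem' c _ ha j := by rw [map_smul, smul_mul_assoc, ha j, smul_zero]

/-- `(M, Ω₁, …, Ω_s)` is a (non-degenerate) polysymplectic manifold of rank `n`, of dimension
`n (s + 1)`. -/
structure IsPolysymplecticManifold {E : Type*} [NormedAddCommGroup E] [NormedSpace ℝ E]
    [FiniteDimensional ℝ E] {M : Type*} [TopologicalSpace M] [ChartedSpace E M] (n : ℕ) {s : ℕ}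
    (Ω : Fin s → DiffForm E M 2) : Prop where
  finrank_eq : Module.finrank ℝ E = n * (s + 1)
  smooth : ∀ j, (Ω j).SmoothOn Set.univ
  closed : ∀ j, (Ω j).ClosedOn Set.univ
  pointwise : ∀ q : M, IsPolysymplecticSpace n fun j => (Ω j q).toAlternatingMap
  /-- The distribution `C^M` is locally generated by closed smooth `1`-forms. -/
  generated : ∀ q₀ : M, ∃ U : Set M, IsOpen U ∧ q₀ ∈ U ∧
    ∃ (m : ℕ) (θ : Fin m → DiffForm E M 1),
      (∀ i, (θ i).SmoothOn U) ∧ (∀ i, (θ i).ClosedOn U) ∧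
      ∀ q ∈ U, Submodule.span ℝ (Set.range fun i => (θ i).covectorAt q) = polyDistribution n Ω q

/-- The space `ℝ^{n(s+1)}` with points `((x_i)_i, (y^j_i)_{j,i})`. -/
abbrev PolyCoord (n s : ℕ) : Type := (Fin n → ℝ) × (Fin s → Fin n → ℝ)

/-- The standard form `∑ i, dx_i ∧ dy^j_i` on `ℝ^{n(s+1)}`. -/
noncomputable def stdPolyForm (n s : ℕ) (j : Fin s) : DiffForm (PolyCoord n s) (PolyCoord n s) 2 :=
  fun z => ∑ i, covectorWedge (V := TangentSpace 𝓘(ℝ, PolyCoord n s) z)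
    (mfderiv 𝓘(ℝ, PolyCoord n s) 𝓘(ℝ, ℝ) (fun w : PolyCoord n s => w.1 i) z)
    (mfderiv 𝓘(ℝ, PolyCoord n s) 𝓘(ℝ, ℝ) (fun w : PolyCoord n s => w.2 j i) z)

/-- `Φ` is a smooth diffeomorphism from an open neighbourhood of `p` onto an open neighbourhood of
`0 = Φ p` in `ℝ^{n(s+1)}` which carries `Ω_j` to `∑ i, dx_i ∧ dy^j_i` for all `j`. -/
structure IsPolysymplecticChartAt {E : Type*} [NormedAddCommGroup E] [NormedSpace ℝ E] {M : Type*}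
    [TopologicalSpace M] [ChartedSpace E M] {n s : ℕ} (Ω : Fin s → DiffForm E M 2) (p : M)
    (Φ : OpenPartialHomeomorph M (PolyCoord n s)) : Prop where
  mem_source : p ∈ Φ.source
  map_eq_zero : Φ p = 0
  contMDiffOn : ContMDiffOn 𝓘(ℝ, E) 𝓘(ℝ, PolyCoord n s) ∞ Φ Φ.source
  contMDiffOn_symm : ContMDiffOn 𝓘(ℝ, PolyCoord n s) 𝓘(ℝ, E) ∞ Φ.symm Φ.target
  form_eq : ∀ j, ∀ q ∈ Φ.source, Ω j q = DiffForm.pullback Φ (stdPolyForm n s j) q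

/-!
# Normal form of polysymplectic manifolds

Pointwise, the theorem is linear algebra. Contracting `Ωⁿ⁺¹ = 0` and `Ω_k ∧ Ω_jⁿ = 0` with vectors
shows that each `Ω_j` has rank `2n` (`finrank_range_flat`) and that the kernel of `Ω_j` is
isotropic for `Ω_k` (`flat_eq_zero_of_mem_ker`). Together with the dimension condition this gives,
for `s ≥ 2`, one `n`-dimensional space `L` of covectors in which the supports of any two of the
forms meet, and all forms lie in the ideal generated by `L`. A basis `φ_i` of `L` therefore
extends to a frame in which `Ω_j = ∑ i, φ_i ∧ ψ^j_i` (`IsPolysymplecticSpace.exists_frame`), and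
`L` is the fibre of the distribution `{α | α ∧ Ω₁ⁿ = ⋯ = α ∧ Ω_sⁿ = 0}`
(`IsPolysymplecticSpace.mem_span_iff`).

For `s ≥ 2` the distribution is generated by closed one-forms, so by the Poincaré lemma it is
spanned near `p` by differentials `dx_i` with prescribed values `φ_i` at `p`
(`IsPolysymplecticManifold.exists_fibration`), and all forms vanish on the fibres of `x`. Linear
functions with differentials `ψ^j_i` at `p` complete the `x_i` to coordinates. The difference
between `Ω_j` and the standard form is closed, vanishes at the base point and on the fibres of
`x`; a primitive of it can be modified by the differential of a function so as to vanish on the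
fibres, and is then `-∑ i, y_i dx_i`. The difference is thus `∑ i, dx_i ∧ dy_i`, where the linear
part of `y_i` is symmetric and can be removed (`exists_eq_sum_dx_wedge_dy`). Adding the `y_i` to
the coordinates `y^j_i` brings all forms into normal form simultaneously, without changing the
coordinates to first order at `p`.

For `s = 1` there is no fibration and the statement is the theorem of Darboux, with prescribed
differential at the base point. It is proved by Moser's method (`exists_darboux`): the primitive
of `w(0) - w` given by the radial homotopy vanishes to second order at the origin, hence so does
the vector field to be integrated, and its flow is tangent to the identity. The flow up to time
one is obtained from the inverse function theorem in the Banach space of paths, applied to the map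
`u ↦ u - ∫ g(t, u)`, which is smooth because superposition operators are
(`contDiff_superposition`). The same fact gives the smoothness of the parametric integrals in the
Poincaré lemmas.
-/

/-! ### Alternating bilinear forms and isotropic subspaces -/

section LinearAlgebra

variable {V : Type*} [AddCommGroup V] [Module ℝ V]

/-- The bilinear form underlying an alternating form of degree two, `v ↦ (w ↦ Ω(v, w))`. -/
def AlternatingMap.flat (Ω : V [⋀^Fin 2]→ₗ[ℝ] ℝ) : V →ₗ[ℝ] Module.Dual ℝ V :=
  LinearMap.mk₂ ℝ (fun v w => Ω ![v, w])
    (fun v v' w => Ω.map_vecCons_add _ v v') (fun c v w => Ω.map_vecCons_smul _ c v)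
    (fun v w w' => by
      have h : ∀ a b : V, Ω ![a, b] = -Ω ![b, a] := fun a b => by
        rw [← Ω.map_swap ![b, a] (i := 0) (j := 1) (by decide)]
        congr 1; ext i; fin_cases i <;> simp
      rw [h v, h v, h v, Ω.map_vecCons_add]; ring)
    (fun c v w => by
      have h : ∀ a b : V, Ω ![a, b] = -Ω ![b, a] := fun a b => by
        rw [← Ω.map_swap ![b, a] (i := 0) (j := 1) (by decide)]
        congr 1; ext i; fin_cases i <;> simp
      rw [h v, h v, Ω.map_vecCons_smul]; simp)

theorem AlternatingMap.flat_apply (Ω : V [⋀^Fin 2]→ₗ[ℝ] ℝ) (v w : V) :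
    Ω.flat v w = Ω ![v, w] := rfl

theorem AlternatingMap.flat_isAlt (Ω : V [⋀^Fin 2]→ₗ[ℝ] ℝ) : LinearMap.IsAlt Ω.flat :=
  fun v => Ω.map_eq_zero_of_eq ![v, v] (i := 0) (j := 1) rfl (by decide)

theorem exists_forall_apply_eq_of_linearIndependent {ι : Type*} [Finite ι]
    {φ : ι → Module.Dual ℝ V} (hφ : LinearIndependent ℝ φ) (c : ι → ℝ) :
    ∃ v, ∀ i, φ i v = c i := by
  have h : LinearIndependent ℝ fun i => (φ i : V → ℝ) :=
    hφ.map' (LinearMap.ltoFun ℝ V ℝ ℝ) (LinearMap.ker_eq_bot.2 DFunLike.coe_injective)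
  have h2 := span_flip_eq_top_iff_linearIndependent.2 h
  have h3 : Set.range (flip fun i => (φ i : V → ℝ)) =
      (LinearMap.range (LinearMap.pi φ) : Set (ι → ℝ)) := rfl
  rw [h3, Submodule.span_eq] at h2
  obtain ⟨v, hv⟩ := LinearMap.range_eq_top.1 h2 c
  exact ⟨v, fun i => congrFun hv i⟩

/-- A two-form which vanishes on the common kernel of independent covectors `φ i` lies in the
ideal that they generate. -/
theorem exists_eq_sum_wedge_of_isotropic {ι : Type*} [Fintype ι] {φ : ι → Module.Dual ℝ V}
    (hφ : LinearIndependent ℝ φ) {B : V →ₗ[ℝ] Module.Dual ℝ V} (hB : LinearMap.IsAlt B)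
    (h : ∀ v w, (∀ i, φ i v = 0) → (∀ i, φ i w = 0) → B v w = 0) :
    ∃ ψ : ι → Module.Dual ℝ V, ∀ v w, B v w = ∑ i, (φ i v * ψ i w - φ i w * ψ i v) := by
  classical
  choose e he using fun i => exists_forall_apply_eq_of_linearIndependent hφ (Pi.single i 1)
  refine ⟨fun i => B (e i) + (1 / 2 : ℝ) • ∑ k, B (e k) (e i) • φ k, fun v w => ?_⟩
  have hp : ∀ v k, φ k (v - ∑ i, φ i v • e i) = 0 := by
    intro v k
    simp [he, Pi.single_apply]
  have h0 := h _ _ (hp v) (hp w)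
  have hneg : ∀ a b, B a b = -B b a := fun a b => (hB.neg a b).symm ▸ (neg_neg _).symm
  have hAA : ∑ i, ∑ k, φ i v * φ k w * B (e i) (e k) =
      -∑ i, ∑ k, φ i v * (φ k w * B (e k) (e i)) := by
    simp only [← Finset.sum_neg_distrib]
    refine Finset.sum_congr rfl fun i _ => Finset.sum_congr rfl fun k _ => ?_
    rw [hneg (e i)]; ring
  have hA' : ∑ i, ∑ k, φ i w * (φ k v * B (e k) (e i)) =
      -∑ i, ∑ k, φ i v * (φ k w * B (e k) (e i)) := by
    rw [Finset.sum_comm]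
    simp only [← Finset.sum_neg_distrib]
    refine Finset.sum_congr rfl fun i _ => Finset.sum_congr rfl fun k _ => ?_
    rw [hneg (e i)]; ring
  simp only [map_sub, map_sum, map_smul, LinearMap.sub_apply, LinearMap.sum_apply,
    LinearMap.smul_apply, smul_eq_mul, mul_sub, Finset.sum_sub_distrib] at h0
  simp only [LinearMap.add_apply, LinearMap.smul_apply, LinearMap.sum_apply, smul_eq_mul,
    mul_add, Finset.sum_sub_distrib, Finset.sum_add_distrib]
  have e1 : ∀ x y : V, ∑ i, φ i x * (1 / 2 * ∑ k, B (e k) (e i) * φ k y) =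
      1 / 2 * ∑ i, ∑ k, φ i x * (φ k y * B (e k) (e i)) := by
    intro x y
    simp only [Finset.mul_sum]
    refine Finset.sum_congr rfl fun i _ => Finset.sum_congr rfl fun k _ => ?_
    ring
  rw [e1, e1, hA']
  have e2 : ∑ x, φ x w * (B v) (e x) = - ∑ x, φ x w * (B (e x)) v := by
    rw [← Finset.sum_neg_distrib]
    exact Finset.sum_congr rfl fun i _ => by rw [hneg v]; ring
  have e3 : ∑ x, φ x w * ∑ y, φ y v * (B (e y)) (e x) =
      ∑ i, ∑ k, φ i v * φ k w * B (e i) (e k) := by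
    simp only [Finset.mul_sum]
    rw [Finset.sum_comm]
    refine Finset.sum_congr rfl fun i _ => Finset.sum_congr rfl fun k _ => ?_
    ring
  linarith [e2, e3, hAA]

theorem exists_linearIndependent_span_eq {X : Type*} [AddCommGroup X] [Module ℝ X]
    [FiniteDimensional ℝ X] (L : Submodule ℝ X) :
    ∃ φ : Fin (Module.finrank ℝ L) → X, LinearIndependent ℝ φ ∧
      Submodule.span ℝ (Set.range φ) = L := by
  refine ⟨fun i => (Module.finBasis ℝ L i : X),
    (Module.finBasis ℝ L).linearIndependent.map' _ (Submodule.ker_subtype _), ?_⟩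
  have h := congrArg (Submodule.map L.subtype) (Module.finBasis ℝ L).span_eq
  rw [Submodule.map_span, ← Set.range_comp, Submodule.map_top, Submodule.range_subtype] at h
  exact h

theorem forall_mem_span_apply_eq_zero_iff {ι : Type*} (φ : ι → Module.Dual ℝ V) (v : V) :
    (∀ α ∈ Submodule.span ℝ (Set.range φ), α v = 0) ↔ ∀ i, φ i v = 0 := by
  refine ⟨fun h i => h _ (Submodule.subset_span ⟨i, rfl⟩), fun h α hα => ?_⟩
  induction hα using Submodule.span_induction with
  | mem x hx => obtain ⟨i, rfl⟩ := hx; exact h i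
  | zero => rfl
  | add x y _ _ hx hy => rw [LinearMap.add_apply, hx, hy, add_zero]
  | smul c x _ hx => rw [LinearMap.smul_apply, hx, smul_zero]

theorem range_le_span_of_eq_sum_wedge {ι : Type*} [Fintype ι] {B : V →ₗ[ℝ] Module.Dual ℝ V}
    {φ ψ : ι → Module.Dual ℝ V}
    (h : ∀ v w, B v w = ∑ i, (φ i v * ψ i w - φ i w * ψ i v)) :
    LinearMap.range B ≤ Submodule.span ℝ (Set.range (Sum.elim φ ψ)) := by
  rintro _ ⟨v, rfl⟩
  have : B v = ∑ i, (φ i v • ψ i - ψ i v • φ i) := by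
    ext w
    rw [h]
    simp [mul_comm]
  rw [this]
  refine Submodule.sum_mem _ fun i _ => Submodule.sub_mem _ (Submodule.smul_mem _ _ ?_)
    (Submodule.smul_mem _ _ ?_)
  · exact Submodule.subset_span ⟨Sum.inr i, rfl⟩
  · exact Submodule.subset_span ⟨Sum.inl i, rfl⟩

theorem range_eq_span_of_eq_sum_wedge {ι : Type*} [Fintype ι] {B : V →ₗ[ℝ] Module.Dual ℝ V}
    {φ ψ : ι → Module.Dual ℝ V} (hi : LinearIndependent ℝ (Sum.elim φ ψ))
    (h : ∀ v w, B v w = ∑ i, (φ i v * ψ i w - φ i w * ψ i v)) :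
    LinearMap.range B = Submodule.span ℝ (Set.range (Sum.elim φ ψ)) := by
  refine le_antisymm (range_le_span_of_eq_sum_wedge h) ?_
  classical
  have hv : ∀ v, B v = ∑ i, (φ i v • ψ i - ψ i v • φ i) := by
    intro v
    ext w
    rw [h]
    simp [mul_comm]
  rw [Submodule.span_le]
  rintro _ ⟨i | i, rfl⟩
  · obtain ⟨v, hv'⟩ := exists_forall_apply_eq_of_linearIndependent hi (Pi.single (Sum.inr i) (-1))
    refine ⟨v, ?_⟩
    have h1 : ∀ k, φ k v = 0 := fun k => by simpa using hv' (Sum.inl k)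
    have h2 : ∀ k, ψ k v = if k = i then -1 else 0 := fun k => by
      simpa [Pi.single_apply] using hv' (Sum.inr k)
    rw [hv]
    ext w
    simp [h1, h2]
  · obtain ⟨v, hv'⟩ := exists_forall_apply_eq_of_linearIndependent hi (Pi.single (Sum.inl i) 1)
    refine ⟨v, ?_⟩
    have h1 : ∀ k, ψ k v = 0 := fun k => by simpa using hv' (Sum.inr k)
    have h2 : ∀ k, φ k v = if k = i then 1 else 0 := fun k => by
      simpa [Pi.single_apply] using hv' (Sum.inl k)
    rw [hv]
    simp [h1, h2]

theorem finrank_range_of_eq_sum_wedge {ι : Type*} [Fintype ι] {B : V →ₗ[ℝ] Module.Dual ℝ V}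
    {φ ψ : ι → Module.Dual ℝ V} (hi : LinearIndependent ℝ (Sum.elim φ ψ))
    (h : ∀ v w, B v w = ∑ i, (φ i v * ψ i w - φ i w * ψ i v)) :
    Module.finrank ℝ (LinearMap.range B) = 2 * Fintype.card ι := by
  rw [range_eq_span_of_eq_sum_wedge hi h, finrank_span_eq_card hi, Fintype.card_sum, two_mul]

variable [FiniteDimensional ℝ V]

/-- Linear Darboux theorem: an alternating form is a sum of products of independent covectors.
The covectors `φ i` cut out a maximal isotropic subspace. -/
theorem exists_independent_eq_sum_wedge {B : V →ₗ[ℝ] Module.Dual ℝ V} (hB : LinearMap.IsAlt B) :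
    ∃ (m : ℕ) (φ ψ : Fin m → Module.Dual ℝ V), LinearIndependent ℝ (Sum.elim φ ψ) ∧
      ∀ v w, B v w = ∑ i, (φ i v * ψ i w - φ i w * ψ i v) := by
  obtain ⟨I, hI⟩ : ∃ I : Submodule ℝ V, Maximal (fun I => ∀ v ∈ I, ∀ w ∈ I, B v w = 0) I := by
    obtain ⟨I, hI, hm⟩ := (wellFounded_gt (α := Submodule ℝ V)).has_min
      {I | ∀ v ∈ I, ∀ w ∈ I, B v w = 0} ⟨⊥, by simp⟩
    exact ⟨I, hI, fun J hJ hIJ => by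
      by_contra hc
      exact hm J hJ (lt_of_le_not_ge hIJ hc)⟩
  have hperp : ∀ v, (∀ w ∈ I, B w v = 0) → v ∈ I := by
    intro v hv
    have hle : I ≤ I ⊔ Submodule.span ℝ {v} := le_sup_left
    refine hI.2 ?_ hle (Submodule.mem_sup_right (Submodule.mem_span_singleton_self v))
    intro a ha b hb
    obtain ⟨a₁, ha₁, a₂, ha₂, rfl⟩ := Submodule.mem_sup.1 ha
    obtain ⟨b₁, hb₁, b₂, hb₂, rfl⟩ := Submodule.mem_sup.1 hb
    obtain ⟨c, rfl⟩ := Submodule.mem_span_singleton.1 ha₂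
    obtain ⟨d, rfl⟩ := Submodule.mem_span_singleton.1 hb₂
    have h1 : B v b₁ = 0 := by rw [← hB.neg, hv b₁ hb₁, neg_zero]
    simp [hI.1 a₁ ha₁ b₁ hb₁, hv a₁ ha₁, h1, hB v]
  obtain ⟨φ, hφ, hspan⟩ := exists_linearIndependent_span_eq I.dualAnnihilator
  have hφI : ∀ v, (∀ i, φ i v = 0) ↔ v ∈ I := by
    intro v
    rw [← Subspace.forall_mem_dualAnnihilator_apply_eq_zero_iff,
      ← forall_mem_span_apply_eq_zero_iff φ v, hspan]
  obtain ⟨ψ, hψ⟩ := exists_eq_sum_wedge_of_isotropic hφ hB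
    fun v w hv hw => hI.1 v ((hφI v).1 hv) w ((hφI w).1 hw)
  refine ⟨_, φ, ψ, ?_, hψ⟩
  rw [Fintype.linearIndependent_iff]
  intro g hg
  simp only [Fintype.sum_sum_type, Sum.elim_inl, Sum.elim_inr] at hg
  -- a vector with coordinates `g (inr i)` is orthogonal to `I`, hence lies in `I`
  obtain ⟨w, hw⟩ := exists_forall_apply_eq_of_linearIndependent hφ fun i => g (Sum.inr i)
  have hwI : w ∈ I := by
    refine hperp w fun v hv => ?_
    have h1 := (hφI v).2 hv
    have h2 := LinearMap.congr_fun hg v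
    simp only [LinearMap.add_apply, LinearMap.sum_apply, LinearMap.smul_apply, h1, smul_eq_mul,
      mul_zero, Finset.sum_const_zero, zero_add, LinearMap.zero_apply] at h2
    rw [hψ]
    simp only [h1, hw, zero_mul, zero_sub, Finset.sum_neg_distrib, h2, neg_zero]
  have hr : ∀ i, g (Sum.inr i) = 0 := fun i => by rw [← hw i, (hφI w).2 hwI i]
  simp only [hr, zero_smul, Finset.sum_const_zero, add_zero] at hg
  have hl := Fintype.linearIndependent_iff.1 hφ _ hg
  rintro (i | i)
  exacts [hl i, hr i]

theorem LinearMap.IsAlt.range_eq_dualAnnihilator_ker {B : V →ₗ[ℝ] Module.Dual ℝ V}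
    (hB : LinearMap.IsAlt B) : LinearMap.range B = (LinearMap.ker B).dualAnnihilator := by
  have h : B.flip = -B := by
    ext v w
    simp [← hB.neg v w]
  rw [LinearMap.dualAnnihilator_ker_eq_range_flip, h, LinearMap.range_neg]

end LinearAlgebra

/-! ### Interior products in the exterior algebra -/

section Exterior

variable {V : Type*} [AddCommGroup V] [Module ℝ V]

/-- The interior product `i_v` on `⋀ V*`. -/
noncomputable def interiorProduct (v : V) :
    ExteriorAlgebra ℝ (Module.Dual ℝ V) →ₗ[ℝ] ExteriorAlgebra ℝ (Module.Dual ℝ V) :=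
  CliffordAlgebra.contractLeft (Q := (0 : QuadraticForm ℝ (Module.Dual ℝ V)))
    (Module.Dual.eval ℝ V v)

theorem interiorProduct_ι_mul (v : V) (α : Module.Dual ℝ V)
    (x : ExteriorAlgebra ℝ (Module.Dual ℝ V)) :
    interiorProduct v (ExteriorAlgebra.ι ℝ α * x) =
      α v • x - ExteriorAlgebra.ι ℝ α * interiorProduct v x :=
  CliffordAlgebra.contractLeft_ι_mul _ _ _

theorem interiorProduct_one (v : V) :
    interiorProduct v (1 : ExteriorAlgebra ℝ (Module.Dual ℝ V)) = 0 :=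
  CliffordAlgebra.contractLeft_one _ _

theorem ι_mul_ι_comm (α β : Module.Dual ℝ V) :
    ExteriorAlgebra.ι ℝ α * ExteriorAlgebra.ι ℝ β =
      -(ExteriorAlgebra.ι ℝ β * ExteriorAlgebra.ι ℝ α) :=
  eq_neg_of_add_eq_zero_left (ExteriorAlgebra.ι_add_mul_swap α β)

theorem ι_mul_ι_mul_comm (α β : Module.Dual ℝ V) (x : ExteriorAlgebra ℝ (Module.Dual ℝ V)) :
    ExteriorAlgebra.ι ℝ α * ExteriorAlgebra.ι ℝ β * x =
      x * (ExteriorAlgebra.ι ℝ α * ExteriorAlgebra.ι ℝ β) := by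
  induction x using ExteriorAlgebra.induction with
  | algebraMap r => exact (Algebra.commutes r _).symm
  | ι γ =>
    rw [mul_assoc, ι_mul_ι_comm β γ, mul_neg, ← mul_assoc, ι_mul_ι_comm α γ, neg_mul, neg_neg,
      mul_assoc]
  | mul a b ha hb => rw [← mul_assoc, ha, mul_assoc, hb, mul_assoc]
  | add a b ha hb => rw [mul_add, ha, hb, add_mul]

variable [FiniteDimensional ℝ V]

theorem twoFormToExterior_eq_sum {ι : Type*} [Fintype ι] (Ω : V [⋀^Fin 2]→ₗ[ℝ] ℝ)
    (φ ψ : ι → Module.Dual ℝ V)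
    (h : ∀ v w, Ω ![v, w] = ∑ i, (φ i v * ψ i w - φ i w * ψ i v)) :
    twoFormToExterior Ω = ∑ i, ExteriorAlgebra.ι ℝ (φ i) * ExteriorAlgebra.ι ℝ (ψ i) := by
  have hex : ∀ α β : Module.Dual ℝ V, ∃ Θ : V [⋀^Fin 2]→ₗ[ℝ] ℝ,
      ∀ v w, Θ ![v, w] = α v * β w - α w * β v := by
    intro α β
    refine ⟨MultilinearMap.alternatization
      ((MultilinearMap.mkPiAlgebra ℝ (Fin 2) ℝ).compLinearMap ![α, β]), fun v w => ?_⟩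
    have h : (Finset.univ : Finset (Equiv.Perm (Fin 2))) = {1, Equiv.swap 0 1} := by decide
    rw [MultilinearMap.alternatization_apply, h, Finset.sum_pair (by decide)]
    simp [Fin.prod_univ_two, sub_eq_add_neg]
  choose Θ hΘ using fun i => hex (φ i) (ψ i)
  simp only [← twoFormToExterior_eq_ι_mul_ι (Θ _) _ _ (hΘ _)]
  simp only [twoFormToExterior, h, ← hΘ, Finset.sum_smul]
  rw [← Finset.smul_sum]
  congr 1
  rw [Finset.sum_comm' (t' := Finset.univ) (s' := fun _ => Finset.univ) (by simp)]
  rw [Finset.sum_comm]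
  conv_rhs => rw [Finset.sum_comm]
  refine Finset.sum_congr rfl fun a _ => ?_
  rw [Finset.sum_comm]

theorem exists_twoFormToExterior_eq_sum (Ω : V [⋀^Fin 2]→ₗ[ℝ] ℝ) :
    ∃ (m : ℕ) (φ ψ : Fin m → Module.Dual ℝ V), LinearIndependent ℝ (Sum.elim φ ψ) ∧
      (∀ v w, Ω.flat v w = ∑ i, (φ i v * ψ i w - φ i w * ψ i v)) ∧
      twoFormToExterior Ω = ∑ i, ExteriorAlgebra.ι ℝ (φ i) * ExteriorAlgebra.ι ℝ (ψ i) := by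
  obtain ⟨m, φ, ψ, hi, h⟩ := exists_independent_eq_sum_wedge Ω.flat_isAlt
  exact ⟨m, φ, ψ, hi, h, twoFormToExterior_eq_sum Ω φ ψ h⟩

theorem twoFormToExterior_mem_center (Ω : V [⋀^Fin 2]→ₗ[ℝ] ℝ) :
    twoFormToExterior Ω ∈ Subalgebra.center ℝ (ExteriorAlgebra ℝ (Module.Dual ℝ V)) := by
  obtain ⟨m, φ, ψ, -, -, h⟩ := exists_twoFormToExterior_eq_sum Ω
  rw [h]
  refine Subalgebra.sum_mem _ fun i _ => ?_
  rw [Subalgebra.mem_center_iff]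
  exact fun b => (ι_mul_ι_mul_comm _ _ b).symm

theorem interiorProduct_twoFormToExterior_mul (Ω : V [⋀^Fin 2]→ₗ[ℝ] ℝ) (v : V)
    (x : ExteriorAlgebra ℝ (Module.Dual ℝ V)) :
    interiorProduct v (twoFormToExterior Ω * x) =
      ExteriorAlgebra.ι ℝ (Ω.flat v) * x + twoFormToExterior Ω * interiorProduct v x := by
  obtain ⟨m, φ, ψ, -, h, h'⟩ := exists_twoFormToExterior_eq_sum Ω
  have hv : Ω.flat v = ∑ i, (φ i v • ψ i - ψ i v • φ i) := by
    ext w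
    rw [h]
    simp [mul_comm]
  rw [h', hv, Finset.sum_mul, Finset.sum_mul, map_sum, map_sum, Finset.sum_mul,
    ← Finset.sum_add_distrib]
  refine Finset.sum_congr rfl fun i _ => ?_
  rw [mul_assoc, interiorProduct_ι_mul, interiorProduct_ι_mul, map_sub, map_smul, map_smul]
  simp only [mul_sub, sub_mul, smul_mul_assoc, mul_smul_comm, mul_assoc]
  abel

theorem interiorProduct_twoFormToExterior (Ω : V [⋀^Fin 2]→ₗ[ℝ] ℝ) (v : V) :
    interiorProduct v (twoFormToExterior Ω) = ExteriorAlgebra.ι ℝ (Ω.flat v) := by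
  simpa [interiorProduct_one] using interiorProduct_twoFormToExterior_mul Ω v 1

theorem twoFormToExterior_mul_comm (Ω : V [⋀^Fin 2]→ₗ[ℝ] ℝ)
    (x : ExteriorAlgebra ℝ (Module.Dual ℝ V)) :
    x * twoFormToExterior Ω = twoFormToExterior Ω * x :=
  Subalgebra.mem_center_iff.1 (twoFormToExterior_mem_center Ω) x

theorem interiorProduct_twoFormToExterior_pow (Ω : V [⋀^Fin 2]→ₗ[ℝ] ℝ) (v : V) (k : ℕ) :
    interiorProduct v (twoFormToExterior Ω ^ k) =
      (k : ℝ) • (ExteriorAlgebra.ι ℝ (Ω.flat v) * twoFormToExterior Ω ^ (k - 1)) := by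
  induction k with
  | zero => simp [interiorProduct_one]
  | succ k ih =>
    rw [pow_succ', interiorProduct_twoFormToExterior_mul, ih, Nat.add_sub_cancel, mul_smul_comm,
      ← mul_assoc, ← twoFormToExterior_mul_comm, mul_assoc]
    rcases k with _ | k
    · simp
    · rw [Nat.add_sub_cancel, ← pow_succ']
      push_cast
      module

/-- The contractions of a two-form with vectors lie in its support. -/
theorem range_flat_le_exteriorSupport (Ω : V [⋀^Fin 2]→ₗ[ℝ] ℝ) :
    LinearMap.range Ω.flat ≤ exteriorSupport (twoFormToExterior Ω) := by
  refine le_sInf fun W hW => ?_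
  obtain ⟨x, hx⟩ := hW
  -- a vector annihilated by `W` contracts `⋀ W` to zero
  have key : ∀ v, (∀ α ∈ W, α v = 0) → ∀ x : ExteriorAlgebra ℝ W,
      interiorProduct v (ExteriorAlgebra.map W.subtype x) = 0 := by
    intro v hv x
    induction x using CliffordAlgebra.left_induction with
    | algebraMap r =>
      rw [AlgHom.commutes]
      exact CliffordAlgebra.contractLeft_algebraMap _ _ _
    | add x y hx hy => rw [map_add, map_add, hx, hy, add_zero]
    | ι_mul x m hx =>
      have h1 := ExteriorAlgebra.map_apply_ι W.subtype m
      rw [map_mul]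
      erw [h1]
      rw [interiorProduct_ι_mul, hx, mul_zero, sub_zero, Submodule.subtype_apply, hv _ m.2,
        zero_smul]
  rw [Ω.flat_isAlt.range_eq_dualAnnihilator_ker,
    ← Subspace.dualCoannihilator_dualAnnihilator_eq (W := W)]
  refine Submodule.dualAnnihilator_anti fun v hv => ?_
  have h := key v (fun α hα => (Submodule.mem_dualCoannihilator v).1 hv α hα) x
  have hx' : ExteriorAlgebra.map W.subtype x = twoFormToExterior Ω := hx
  rw [hx', interiorProduct_twoFormToExterior, ExteriorAlgebra.ι_eq_zero_iff] at h
  exact h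

/-- `i_v` of the relation `Ωⁿ⁺¹ = 0` reads `(n + 1) Ω(v, ·) ∧ Ωⁿ = 0`. -/
theorem ι_mul_pow_eq_zero {Ω : V [⋀^Fin 2]→ₗ[ℝ] ℝ} {n : ℕ}
    (h : twoFormToExterior Ω ^ (n + 1) = 0) {α : Module.Dual ℝ V}
    (hα : α ∈ LinearMap.range Ω.flat) :
    ExteriorAlgebra.ι ℝ α * twoFormToExterior Ω ^ n = 0 := by
  obtain ⟨v, rfl⟩ := hα
  have h1 := interiorProduct_twoFormToExterior_pow Ω v (n + 1)
  rw [h, map_zero, Nat.add_sub_cancel] at h1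
  exact (smul_eq_zero.1 h1.symm).resolve_left (by positivity)

/-- If `Ωⁿ ≠ 0`, then `α ∧ Ωⁿ = 0` forces `α` to vanish on the kernel of `Ω`. -/
theorem mem_range_flat_of_ι_mul_pow_eq_zero {Ω : V [⋀^Fin 2]→ₗ[ℝ] ℝ} {n : ℕ}
    (h : twoFormToExterior Ω ^ n ≠ 0) {α : Module.Dual ℝ V}
    (hα : ExteriorAlgebra.ι ℝ α * twoFormToExterior Ω ^ n = 0) :
    α ∈ LinearMap.range Ω.flat := by
  rw [Ω.flat_isAlt.range_eq_dualAnnihilator_ker, Submodule.mem_dualAnnihilator]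
  intro v hv
  have h1 := interiorProduct_ι_mul v α (twoFormToExterior Ω ^ n)
  rw [hα, map_zero, interiorProduct_twoFormToExterior_pow, LinearMap.mem_ker.1 hv, map_zero,
    zero_mul, smul_zero, mul_zero, sub_zero] at h1
  exact (smul_eq_zero.1 h1.symm).resolve_right h

/-- If `Ωⁿ ≠ 0` and `Ωⁿ⁺¹ = 0` then `Ω` has rank `2n`: writing `Ω = ∑ φᵢ ∧ ψᵢ` with `m` terms,
one has `Ωⁿ = n φᵢ ∧ ψᵢ ∧ Ωⁿ⁻¹` for all `i`, and the sum over `i` is `m Ωⁿ = n Ωⁿ`. -/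
theorem finrank_range_flat {Ω : V [⋀^Fin 2]→ₗ[ℝ] ℝ} {n : ℕ}
    (h0 : twoFormToExterior Ω ^ n ≠ 0) (h1 : twoFormToExterior Ω ^ (n + 1) = 0) :
    Module.finrank ℝ (LinearMap.range Ω.flat) = 2 * n := by
  classical
  obtain ⟨m, φ, ψ, hi, h, h'⟩ := exists_twoFormToExterior_eq_sum Ω
  rw [finrank_range_of_eq_sum_wedge hi h, Fintype.card_fin]
  suffices hmn : m = n by rw [hmn]
  have hv : ∀ v, Ω.flat v = ∑ i, (φ i v • ψ i - ψ i v • φ i) := by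
    intro v
    ext w
    rw [h]
    simp [mul_comm]
  have key : ∀ i, twoFormToExterior Ω ^ n = (n : ℝ) •
      (ExteriorAlgebra.ι ℝ (φ i) * ExteriorAlgebra.ι ℝ (ψ i) *
        twoFormToExterior Ω ^ (n - 1)) := by
    intro i
    have hφ : φ i ∈ LinearMap.range Ω.flat := by
      rw [range_eq_span_of_eq_sum_wedge hi h]
      exact Submodule.subset_span ⟨Sum.inl i, rfl⟩
    obtain ⟨v, hv'⟩ := exists_forall_apply_eq_of_linearIndependent hi (Pi.single (Sum.inl i) 1)
    have e1 : ∀ k, ψ k v = 0 := fun k => by simpa using hv' (Sum.inr k)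
    have e2 : ∀ k, φ k v = if k = i then 1 else 0 := fun k => by
      simpa [Pi.single_apply] using hv' (Sum.inl k)
    have e3 : Ω.flat v = ψ i := by
      rw [hv]
      ext w
      simp [e1, e2]
    have e4 := interiorProduct_ι_mul v (φ i) (twoFormToExterior Ω ^ n)
    rw [ι_mul_pow_eq_zero h1 hφ, map_zero, interiorProduct_twoFormToExterior_pow, e3, e2,
      if_pos rfl, one_smul, mul_smul_comm, ← mul_assoc] at e4
    exact sub_eq_zero.1 e4.symm
  have hsum : (m : ℝ) • twoFormToExterior Ω ^ n = (n : ℝ) • twoFormToExterior Ω ^ n := by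
    have e : ∑ _i : Fin m, twoFormToExterior Ω ^ n = (n : ℝ) •
        (twoFormToExterior Ω * twoFormToExterior Ω ^ (n - 1)) := by
      rw [Finset.sum_congr rfl fun i _ => key i, ← Finset.smul_sum, ← Finset.sum_mul, ← h']
    rw [Finset.sum_const, Finset.card_univ, Fintype.card_fin, ← Nat.cast_smul_eq_nsmul ℝ] at e
    rw [e]
    rcases n with _ | n
    · simp
    · rw [Nat.add_sub_cancel, ← pow_succ']
  have := sub_eq_zero.2 hsum
  rw [← sub_smul] at this
  have h2 := (smul_eq_zero.1 this).resolve_right h0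
  exact_mod_cast sub_eq_zero.1 h2

/-- If `Ωⁿ ≠ 0` and `Ω' ∧ Ωⁿ = 0` then the kernel of `Ω` is isotropic for `Ω'`. -/
theorem flat_eq_zero_of_mem_ker {Ω Ω' : V [⋀^Fin 2]→ₗ[ℝ] ℝ} {n : ℕ}
    (h0 : twoFormToExterior Ω ^ n ≠ 0)
    (h1 : twoFormToExterior Ω' * twoFormToExterior Ω ^ n = 0) {v w : V}
    (hv : v ∈ LinearMap.ker Ω.flat) (hw : w ∈ LinearMap.ker Ω.flat) : Ω'.flat v w = 0 := by
  have e : ∀ u ∈ LinearMap.ker Ω.flat, interiorProduct u (twoFormToExterior Ω ^ n) = 0 := by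
    intro u hu
    rw [interiorProduct_twoFormToExterior_pow, LinearMap.mem_ker.1 hu, map_zero, zero_mul,
      smul_zero]
  have h2 := interiorProduct_twoFormToExterior_mul Ω' v (twoFormToExterior Ω ^ n)
  rw [h1, map_zero, e v hv, mul_zero, add_zero] at h2
  have h3 := interiorProduct_ι_mul w (Ω'.flat v) (twoFormToExterior Ω ^ n)
  rw [← h2, map_zero, e w hw, mul_zero, sub_zero] at h3
  exact (smul_eq_zero.1 h3.symm).resolve_right h0

theorem wedgeMonomial_single_add_single {s : ℕ} (Ω : Fin s → V [⋀^Fin 2]→ₗ[ℝ] ℝ) (j k : Fin s)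
    (a b : ℕ) :
    wedgeMonomial Ω (Pi.single j a + Pi.single k b) =
      twoFormToExterior (Ω j) ^ a * twoFormToExterior (Ω k) ^ b := by
  classical
  let c : Fin s → Subalgebra.center ℝ (ExteriorAlgebra ℝ (Module.Dual ℝ V)) :=
    fun i => ⟨twoFormToExterior (Ω i), twoFormToExterior_mem_center (Ω i)⟩
  have hc : ∀ h : Fin s → ℕ, wedgeMonomial Ω h = (∏ i, c i ^ h i :
      Subalgebra.center ℝ (ExteriorAlgebra ℝ (Module.Dual ℝ V))) := by
    intro h
    rw [wedgeMonomial, ← List.prod_ofFn]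
    change _ = (Subalgebra.center ℝ (ExteriorAlgebra ℝ (Module.Dual ℝ V))).val _
    rw [map_list_prod, List.map_ofFn]
    rfl
  rw [hc]
  simp only [Pi.add_apply, pow_add, Finset.prod_mul_distrib]
  rw [Finset.prod_eq_single j (fun i _ hi => by simp [hi]) (by simp),
    Finset.prod_eq_single k (fun i _ hi => by simp [hi]) (by simp)]
  simp [c]

end Exterior

/-! ### Normal form of a polysymplectic vector space -/

section Frames

variable {V : Type*} [AddCommGroup V] [Module ℝ V]

/-- Covectors `φ i`, `ψ j i` in which the forms `Ω j` take the normal form `∑ i, φ i ∧ ψ j i`. -/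
def IsPolyFrame {n s : ℕ} (Ω : Fin s → V [⋀^Fin 2]→ₗ[ℝ] ℝ) (φ : Fin n → Module.Dual ℝ V)
    (ψ : Fin s → Fin n → Module.Dual ℝ V) : Prop :=
  ∀ j v w, (Ω j).flat v w = ∑ i, (φ i v * ψ j i w - φ i w * ψ j i v)

variable {n s : ℕ} {Ω : Fin s → V [⋀^Fin 2]→ₗ[ℝ] ℝ}

theorem IsPolysymplecticSpace.range_inf_range_le {j k : Fin s} (h : k ≠ j) :
    LinearMap.range (Ω j).flat ⊓ LinearMap.range (Ω k).flat ≤ LinearMap.range (Ω j).flat ⊓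
      ⨆ k : {k : Fin s // k ≠ j}, LinearMap.range (Ω k.1).flat :=
  inf_le_inf le_rfl (le_iSup (fun k : {k : Fin s // k ≠ j} => LinearMap.range (Ω k.1).flat) ⟨k, h⟩)

variable [FiniteDimensional ℝ V]

namespace IsPolysymplecticSpace

theorem pow_ne_zero (hΩ : IsPolysymplecticSpace n Ω) (j : Fin s) :
    twoFormToExterior (Ω j) ^ n ≠ 0 := by
  have h := hΩ.independent.ne_zero ⟨Pi.single j n, by simp⟩
  have e := wedgeMonomial_single_add_single Ω j j n 0
  simp only [Pi.single_zero, add_zero, pow_zero, mul_one] at e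
  rwa [e] at h

theorem mul_pow_eq_zero (hΩ : IsPolysymplecticSpace n Ω) (j k : Fin s) :
    twoFormToExterior (Ω k) * twoFormToExterior (Ω j) ^ n = 0 := by
  have h := hΩ.vanishing (Pi.single k 1 + Pi.single j n)
    (by simp [Finset.sum_add_distrib, add_comm])
  rwa [wedgeMonomial_single_add_single, pow_one] at h

theorem finrank_range (hΩ : IsPolysymplecticSpace n Ω) (j : Fin s) :
    Module.finrank ℝ (LinearMap.range (Ω j).flat) = 2 * n :=
  finrank_range_flat (hΩ.pow_ne_zero j) (by rw [pow_succ', hΩ.mul_pow_eq_zero])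

theorem finrank_range_inf_le (hΩ : IsPolysymplecticSpace n Ω) (j : Fin s) :
    Module.finrank ℝ ↥(LinearMap.range (Ω j).flat ⊓
      ⨆ k : {k : Fin s // k ≠ j}, LinearMap.range (Ω k.1).flat) ≤ n :=
  (Submodule.finrank_mono (inf_le_inf (range_flat_le_exteriorSupport _)
    (iSup_mono fun _ => range_flat_le_exteriorSupport _))).trans (hΩ.finrank_inf_le j)

theorem linearIndependent_pair (hΩ : IsPolysymplecticSpace n Ω) {φ : Fin n → Module.Dual ℝ V}
    {ψ : Fin s → Fin n → Module.Dual ℝ V} (hf : IsPolyFrame Ω φ ψ) (j : Fin s) :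
    LinearIndependent ℝ (Sum.elim φ (ψ j)) := by
  rw [linearIndependent_iff_card_le_finrank_span]
  have h := Submodule.finrank_mono (range_le_span_of_eq_sum_wedge (hf j))
  rw [hΩ.finrank_range] at h
  simpa [two_mul, Set.finrank] using h

theorem span_le_range (hΩ : IsPolysymplecticSpace n Ω) {φ : Fin n → Module.Dual ℝ V}
    {ψ : Fin s → Fin n → Module.Dual ℝ V} (hf : IsPolyFrame Ω φ ψ) (j : Fin s) :
    Submodule.span ℝ (Set.range φ) ≤ LinearMap.range (Ω j).flat := by
  rw [range_eq_span_of_eq_sum_wedge (hΩ.linearIndependent_pair hf j) (hf j)]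
  refine Submodule.span_mono ?_
  rintro _ ⟨i, rfl⟩
  exact ⟨Sum.inl i, rfl⟩

/-- In a frame the covectors `φ i` span the intersection of the support of one of the forms with
the sum of the others. -/
theorem range_inf_iSup_eq_span (hΩ : IsPolysymplecticSpace n Ω) {φ : Fin n → Module.Dual ℝ V}
    {ψ : Fin s → Fin n → Module.Dual ℝ V} (hf : IsPolyFrame Ω φ ψ) {j l : Fin s} (hl : l ≠ j) :
    Submodule.span ℝ (Set.range φ) = LinearMap.range (Ω j).flat ⊓
      ⨆ k : {k : Fin s // k ≠ j}, LinearMap.range (Ω k.1).flat := by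
  refine Submodule.eq_of_le_of_finrank_le
    ((le_inf (hΩ.span_le_range hf j) (hΩ.span_le_range hf l)).trans (range_inf_range_le hl)) ?_
  have hφ : LinearIndependent ℝ φ :=
    (hΩ.linearIndependent_pair hf j).comp Sum.inl Sum.inl_injective
  rw [finrank_span_eq_card hφ, Fintype.card_fin]
  exact hΩ.finrank_range_inf_le j

/-- The covectors of a frame are independent: by the dimension condition, a relation between the
`ψ j i` modulo the `φ i` splits into relations for each `j`, and `Ω j` has rank `2n`. -/
theorem linearIndependent_frame (hΩ : IsPolysymplecticSpace n Ω) (hs : 1 ≤ s)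
    {φ : Fin n → Module.Dual ℝ V} {ψ : Fin s → Fin n → Module.Dual ℝ V}
    (hf : IsPolyFrame Ω φ ψ) :
    LinearIndependent ℝ (Sum.elim φ fun a : Fin s × Fin n => ψ a.1 a.2) := by
  classical
  rw [Fintype.linearIndependent_iff]
  intro g hg
  simp only [Fintype.sum_sum_type, Sum.elim_inl, Sum.elim_inr, Fintype.sum_prod_type] at hg
  have hr : ∀ j i, g (Sum.inr (j, i)) = 0 := by
    intro j
    have hmem : ∑ i, g (Sum.inr (j, i)) • ψ j i ∈ Submodule.span ℝ (Set.range φ) := by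
      have hφ : ∑ i, g (Sum.inl i) • φ i ∈ Submodule.span ℝ (Set.range φ) :=
        Submodule.sum_mem _ fun i _ => Submodule.smul_mem _ _ (Submodule.subset_span ⟨i, rfl⟩)
      rw [← Finset.add_sum_erase _ _ (Finset.mem_univ j)] at hg
      have e : ∑ i, g (Sum.inr (j, i)) • ψ j i = -(∑ i, g (Sum.inl i) • φ i) -
          ∑ k ∈ Finset.univ.erase j, ∑ i, g (Sum.inr (k, i)) • ψ k i := by
        rw [eq_sub_iff_add_eq, eq_neg_iff_add_eq_zero, ← hg]
        abel
      by_cases hl : ∃ l, l ≠ j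
      · obtain ⟨l, hl⟩ := hl
        have hψ : ∀ k i, ψ k i ∈ LinearMap.range (Ω k).flat := by
          intro k i
          rw [range_eq_span_of_eq_sum_wedge (hΩ.linearIndependent_pair hf k) (hf k)]
          exact Submodule.subset_span ⟨Sum.inr i, rfl⟩
        rw [hΩ.range_inf_iSup_eq_span hf hl]
        refine ⟨Submodule.sum_mem _ fun i _ => Submodule.smul_mem _ _ (hψ j i), ?_⟩
        rw [hΩ.range_inf_iSup_eq_span hf hl] at hφ
        rw [e]
        refine Submodule.sub_mem _ (Submodule.neg_mem _ hφ.2) (Submodule.sum_mem _ fun k hk =>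
          Submodule.sum_mem _ fun i _ => Submodule.smul_mem _ _ ?_)
        exact Submodule.mem_iSup_of_mem (⟨k, Finset.ne_of_mem_erase hk⟩ : {k : Fin s // k ≠ j})
          (hψ k i)
      · rw [e, Finset.sum_eq_zero (s := Finset.univ.erase j), sub_zero]
        · exact Submodule.neg_mem _ hφ
        · intro k hk
          exact absurd ⟨k, Finset.ne_of_mem_erase hk⟩ hl
    obtain ⟨c, hc⟩ := (Submodule.mem_span_range_iff_exists_fun ℝ).1 hmem
    have h := Fintype.linearIndependent_iff.1 (hΩ.linearIndependent_pair hf j)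
      (Sum.elim (fun i => -c i) fun i => g (Sum.inr (j, i))) (by
        simp only [Fintype.sum_sum_type, Sum.elim_inl, Sum.elim_inr, neg_smul,
          Finset.sum_neg_distrib, ← hc, neg_add_cancel])
    exact fun i => h (Sum.inr i)
  simp only [hr, zero_smul, Finset.sum_const_zero, add_zero] at hg
  have hφ : LinearIndependent ℝ φ :=
    (hΩ.linearIndependent_pair hf ⟨0, hs⟩).comp Sum.inl Sum.inl_injective
  have hl := Fintype.linearIndependent_iff.1 hφ _ hg
  rintro (i | ⟨j, i⟩)
  exacts [hl i, hr j i]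

/-- For `s ≥ 2` the covectors `φ i` of a frame span `{α | α ∧ Ω₁ⁿ = ⋯ = α ∧ Ω_sⁿ = 0}`. -/
theorem mem_span_iff (hΩ : IsPolysymplecticSpace n Ω) (hs : 2 ≤ s)
    {φ : Fin n → Module.Dual ℝ V} {ψ : Fin s → Fin n → Module.Dual ℝ V}
    (hf : IsPolyFrame Ω φ ψ) (α : Module.Dual ℝ V) :
    α ∈ Submodule.span ℝ (Set.range φ) ↔
      ∀ j, ExteriorAlgebra.ι ℝ α * twoFormToExterior (Ω j) ^ n = 0 := by
  refine ⟨fun h j => ι_mul_pow_eq_zero (by rw [pow_succ', hΩ.mul_pow_eq_zero])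
    (hΩ.span_le_range hf j h), fun h => ?_⟩
  have hne : (⟨1, hs⟩ : Fin s) ≠ ⟨0, by omega⟩ := by simp
  rw [hΩ.range_inf_iSup_eq_span hf hne]
  exact range_inf_range_le hne ⟨mem_range_flat_of_ι_mul_pow_eq_zero (hΩ.pow_ne_zero _) (h _),
    mem_range_flat_of_ι_mul_pow_eq_zero (hΩ.pow_ne_zero _) (h _)⟩

/-- The supports of two of the forms meet in a space of dimension `d ≥ n`: modulo the common kernel,
the kernel of `Ω j` has dimension `2n - d`, and `Ω k` embeds it into this space. -/
theorem finrank_range_inf_range (hΩ : IsPolysymplecticSpace n Ω) (j k : Fin s) :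
    n ≤ Module.finrank ℝ ↥(LinearMap.range (Ω j).flat ⊓ LinearMap.range (Ω k).flat) := by
  -- `Ω k` maps the kernel of `Ω j` into the intersection of the supports
  have hle : Submodule.map (Ω k).flat (LinearMap.ker (Ω j).flat) ≤
      LinearMap.range (Ω j).flat ⊓ LinearMap.range (Ω k).flat := by
    rintro _ ⟨v, hv, rfl⟩
    refine ⟨?_, ⟨v, rfl⟩⟩
    rw [(Ω j).flat_isAlt.range_eq_dualAnnihilator_ker]
    exact (Submodule.mem_dualAnnihilator _).2 fun w hw =>
      flat_eq_zero_of_mem_ker (hΩ.pow_ne_zero j) (hΩ.mul_pow_eq_zero j k) hv hw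
  have h1 := Submodule.finrank_mono hle
  have h2 := LinearMap.finrank_range_add_finrank_ker
    ((Ω k).flat.domRestrict (LinearMap.ker (Ω j).flat))
  rw [LinearMap.range_domRestrict] at h2
  have h5 : Module.finrank ℝ (LinearMap.ker ((Ω k).flat.domRestrict (LinearMap.ker (Ω j).flat))) ≤
      Module.finrank ℝ ↥(LinearMap.ker (Ω j).flat ⊓ LinearMap.ker (Ω k).flat) := by
    rw [← Submodule.finrank_map_subtype_eq]
    refine Submodule.finrank_mono ?_
    rintro _ ⟨v, hv, rfl⟩
    exact ⟨v.2, hv⟩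
  have h6 := Subspace.finrank_add_finrank_dualAnnihilator_eq
    (LinearMap.ker (Ω j).flat ⊓ LinearMap.ker (Ω k).flat)
  rw [Subspace.dualAnnihilator_inf_eq, ← (Ω j).flat_isAlt.range_eq_dualAnnihilator_ker,
    ← (Ω k).flat_isAlt.range_eq_dualAnnihilator_ker] at h6
  have h3 := Submodule.finrank_sup_add_finrank_inf_eq (LinearMap.range (Ω j).flat)
    (LinearMap.range (Ω k).flat)
  rw [hΩ.finrank_range, hΩ.finrank_range] at h3
  have h4 := LinearMap.finrank_range_add_finrank_ker (Ω j).flat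
  rw [hΩ.finrank_range] at h4
  omega

/-- Frames exist. For `s ≥ 2` the supports of any two forms meet in one and the same `n`-dimensional
space `L`, and the common kernel of `L` is `ker Ω_j + ker Ω_k` for all `k ≠ j`, which is isotropic
for `Ω_j`. A basis of `L` serves as `φ`. For `s = 1` this is the linear Darboux theorem. -/
theorem exists_frame (hΩ : IsPolysymplecticSpace n Ω) (hs : 1 ≤ s) :
    ∃ (φ : Fin n → Module.Dual ℝ V) (ψ : Fin s → Fin n → Module.Dual ℝ V),
      IsPolyFrame Ω φ ψ := by
  have hcast : ∀ {m : ℕ}, m = n → ∀ (φ : Fin m → Module.Dual ℝ V), LinearIndependent ℝ φ →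
      (∀ j v w, (∀ i, φ i v = 0) → (∀ i, φ i w = 0) → (Ω j).flat v w = 0) →
      ∃ (φ : Fin n → Module.Dual ℝ V) (ψ : Fin s → Fin n → Module.Dual ℝ V),
      IsPolyFrame Ω φ ψ := by
    rintro m rfl φ hφ h
    choose ψ hψ using fun j => exists_eq_sum_wedge_of_isotropic hφ (Ω j).flat_isAlt (h j)
    exact ⟨φ, ψ, hψ⟩
  rcases Nat.lt_or_ge 1 s with hs2 | hs1
  · let L : Fin s → Submodule ℝ (Module.Dual ℝ V) := fun j => LinearMap.range (Ω j).flat ⊓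
      ⨆ k : {k : Fin s // k ≠ j}, LinearMap.range (Ω k.1).flat
    have hL : ∀ j k, k ≠ j → LinearMap.range (Ω j).flat ⊓ LinearMap.range (Ω k).flat = L j :=
      fun j k h => Submodule.eq_of_le_of_finrank_le (range_inf_range_le h)
        ((hΩ.finrank_range_inf_le j).trans (hΩ.finrank_range_inf_range _ _))
    have hLL : ∀ j k, L j = L k := by
      intro j k
      rcases eq_or_ne k j with rfl | h
      · rfl
      · rw [← hL j k h, ← hL k j h.symm, inf_comm]
    let z : Fin s := ⟨0, by omega⟩
    obtain ⟨φ, hφ, hspan⟩ := exists_linearIndependent_span_eq (L z)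
    have hne : (⟨1, hs2⟩ : Fin s) ≠ z := by simp [z]
    refine hcast (le_antisymm (hΩ.finrank_range_inf_le z) ?_) φ hφ fun j v w hv hw => ?_
    · have := hΩ.finrank_range_inf_range z ⟨1, hs2⟩
      rwa [hL z _ hne] at this
    · obtain ⟨k, hk⟩ : ∃ k : Fin s, k ≠ j := by
        rcases eq_or_ne j z with rfl | h
        exacts [⟨_, hne⟩, ⟨z, h.symm⟩]
      have hmem : ∀ u, (∀ i, φ i u = 0) →
          u ∈ LinearMap.ker (Ω j).flat ⊔ LinearMap.ker (Ω k).flat := by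
        intro u hu
        rw [← Subspace.forall_mem_dualAnnihilator_apply_eq_zero_iff]
        intro α hα
        refine (forall_mem_span_apply_eq_zero_iff φ u).2 hu α ?_
        rw [hspan, hLL z j, ← hL j k hk]
        rw [Submodule.dualAnnihilator_sup_eq] at hα
        rwa [(Ω j).flat_isAlt.range_eq_dualAnnihilator_ker,
          (Ω k).flat_isAlt.range_eq_dualAnnihilator_ker]
      obtain ⟨a, ha, b, hb, rfl⟩ := Submodule.mem_sup.1 (hmem v hv)
      obtain ⟨c, hc, d, hd, rfl⟩ := Submodule.mem_sup.1 (hmem w hw)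
      have h1 : (Ω j).flat b c = 0 := by
        rw [← (Ω j).flat_isAlt.neg, LinearMap.mem_ker.1 hc, LinearMap.zero_apply, neg_zero]
      have h2 := flat_eq_zero_of_mem_ker (hΩ.pow_ne_zero k) (hΩ.mul_pow_eq_zero k j) hb hd
      rw [map_add, map_add, LinearMap.mem_ker.1 ha, zero_add, h1, h2, add_zero]
  · obtain rfl : s = 1 := by omega
    obtain ⟨m, φ, ψ, hi, h⟩ := exists_independent_eq_sum_wedge (Ω 0).flat_isAlt
    have hm := finrank_range_of_eq_sum_wedge hi h
    rw [hΩ.finrank_range, Fintype.card_fin] at hm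
    obtain rfl : m = n := by omega
    exact ⟨φ, fun _ => ψ, fun j => by rw [Subsingleton.elim j 0]; exact h⟩

end IsPolysymplecticSpace

end Frames

/-! ### Superposition operators and parametric integrals -/

section Analysis

open Filter Topology unitInterval

universe u

/-- A function which is smooth on a neighbourhood of a closed set `K` agrees near `K` with a
globally smooth one. -/
theorem exists_contDiff_eventuallyEq_nhdsSet {E F : Type*} [NormedAddCommGroup E]
    [NormedSpace ℝ E] [FiniteDimensional ℝ E] [NormedAddCommGroup F] [NormedSpace ℝ F]
    {f : E → F} {K : Set E} (hK : IsClosed K)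
    (hf : ∀ᶠ x in 𝓝ˢ K, ContDiffAt ℝ ∞ f x) :
    ∃ g : E → F, ContDiff ℝ ∞ g ∧ ∀ᶠ x in 𝓝ˢ K, g x = f x := by
  obtain ⟨W, hW, hKW, hfW⟩ := eventually_nhdsSet_iff_exists.1 hf
  obtain ⟨χ, h0, h1, -⟩ := exists_contMDiffMap_zero_one_nhds_of_isClosed 𝓘(ℝ, E) (n := ⊤)
    hW.isClosed_compl hK (Set.disjoint_compl_left_iff_subset.2 hKW)
  have hχ : ContDiff ℝ ∞ χ := χ.contMDiff.contDiff
  refine ⟨fun x => χ x • f x, contDiff_iff_contDiffAt.2 fun x => ?_, ?_⟩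
  · by_cases hx : x ∈ W
    · exact hχ.contDiffAt.smul (hfW x hx)
    · have h : (fun x => χ x • f x) =ᶠ[𝓝 x] fun _ => 0 := by
        filter_upwards [h0.filter_mono (nhds_le_nhdsSet hx)] with y hy
        rw [hy, zero_smul]
      exact contDiffAt_const.congr_of_eventuallyEq h
  · filter_upwards [h1] with x hx
    rw [hx, one_smul]

theorem exists_contDiff_eventuallyEq_nhds {E F : Type*} [NormedAddCommGroup E]
    [NormedSpace ℝ E] [FiniteDimensional ℝ E] [NormedAddCommGroup F] [NormedSpace ℝ F]
    {f : E → F} {x₀ : E} (hf : ∀ᶠ x in 𝓝 x₀, ContDiffAt ℝ ∞ f x) :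
    ∃ g : E → F, ContDiff ℝ ∞ g ∧ ∀ᶠ x in 𝓝 x₀, g x = f x := by
  rw [← nhdsSet_singleton] at hf ⊢
  exact exists_contDiff_eventuallyEq_nhdsSet isClosed_singleton hf

section Superposition

variable {T : Type*} [TopologicalSpace T] [CompactSpace T]
variable {E F : Type*} [NormedAddCommGroup E] [NormedSpace ℝ E] [NormedAddCommGroup F]
  [NormedSpace ℝ F]

/-- Pointwise application `A ↦ (h ↦ (t ↦ A t (h t)))` as a continuous bilinear map. -/
noncomputable def pointwiseApplyCLM (T E F : Type*) [TopologicalSpace T] [CompactSpace T]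
    [NormedAddCommGroup E] [NormedSpace ℝ E] [NormedAddCommGroup F] [NormedSpace ℝ F] :
    C(T, E →L[ℝ] F) →L[ℝ] C(T, E) →L[ℝ] C(T, F) :=
  LinearMap.mkContinuous₂
    (LinearMap.mk₂ ℝ
      (fun (A : C(T, E →L[ℝ] F)) (h : C(T, E)) => (⟨fun t => A t (h t), by fun_prop⟩ : C(T, F)))
      (fun A B h => by ext t; simp) (fun c A h => by ext t; simp)
      (fun A h k => by ext t; simp) (fun c A h => by ext t; simp)) 1
    (fun A h => by
      refine (ContinuousMap.norm_le _ (by positivity)).2 fun t => ?_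
      rw [one_mul]
      exact ((A t).le_opNorm (h t)).trans (mul_le_mul (A.norm_coe_le_norm t)
        (h.norm_coe_le_norm t) (norm_nonneg (h t)) (norm_nonneg A)))

/-- The derivative of `u ↦ f ∘ u` at `u` is `h ↦ (t ↦ Df(u t)(h t))`; the remainder is uniformly small
as `Df` is uniformly continuous near the compact image of `u`. -/
theorem hasFDerivAt_continuousMap_comp {f : E → F} (hf : ContDiff ℝ ∞ f) (u : C(T, E)) :
    HasFDerivAt (fun u : C(T, E) => (⟨f, hf.continuous⟩ : C(E, F)).comp u)
      (pointwiseApplyCLM T E F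
        ((⟨fderiv ℝ f, hf.continuous_fderiv (by simp)⟩ : C(E, E →L[ℝ] F)).comp u)) u := by
  rw [hasFDerivAt_iff_isLittleO_nhds_zero, Asymptotics.isLittleO_iff]
  intro c hc
  have hcont := hf.continuous_fderiv (by simp)
  -- the derivative of `f` is uniformly close to its value along `u`
  have h1 : ∀ᶠ k in 𝓝 (0 : E), ∀ t ∈ (Set.univ : Set T),
      ‖fderiv ℝ f (u t + k) - fderiv ℝ f (u t)‖ < c := by
    refine isCompact_univ.eventually_forall_of_forall_eventually fun t _ => ?_
    have : Continuous fun z : E × T =>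
        ‖fderiv ℝ f (u z.2 + z.1) - fderiv ℝ f (u z.2)‖ := by fun_prop
    exact this.continuousAt.eventually_lt continuousAt_const (by simpa using hc)
  obtain ⟨δ, hδ, hb⟩ := Metric.eventually_nhds_iff_ball.1 h1
  filter_upwards [Metric.ball_mem_nhds (0 : C(T, E)) hδ] with h hh
  refine (ContinuousMap.norm_le _ (by positivity)).2 fun t => ?_
  have hht : ‖h t‖ < δ := (h.norm_coe_le_norm t).trans_lt (by simpa using hh)
  have hmv := (convex_ball (0 : E) δ).norm_image_sub_le_of_norm_fderiv_le'
    (f := fun k => f (u t + k)) (φ := fderiv ℝ f (u t)) (C := c) (x := 0) (y := h t)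
    (fun k _ => ((hf.differentiable (by simp)).comp (by fun_prop)).differentiableAt)
    (fun k hk => by
      rw [fderiv_comp_add_left]
      exact (hb k hk t (Set.mem_univ t)).le) (by simpa using hδ) (by simpa using hht)
  simp only [add_zero, sub_zero] at hmv
  exact hmv.trans (mul_le_mul_of_nonneg_left (h.norm_coe_le_norm t) hc.le)

/-- Composition with a smooth map is smooth on spaces of continuous maps. -/
theorem contDiff_continuousMap_comp {E F : Type u} [NormedAddCommGroup E]
    [NormedSpace ℝ E] [NormedAddCommGroup F] [NormedSpace ℝ F]
    {f : E → F} (hf : ContDiff ℝ ∞ f) :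
    ContDiff ℝ ∞ (fun u : C(T, E) => (⟨f, hf.continuous⟩ : C(E, F)).comp u) := by
  refine contDiff_infty.2 fun m => ?_
  induction m generalizing F with
  | zero => exact contDiff_zero.2 (ContinuousMap.continuous_postcomp _)
  | succ m ih =>
    have hf' : ContDiff ℝ ∞ (fderiv ℝ f) := hf.fderiv_right (by simp)
    have h := ih hf'
    have h' := (ContinuousLinearMap.contDiff (n := (m : ℕ∞ω))
      (pointwiseApplyCLM T E F)).comp h
    exact contDiff_succ_iff_hasFDerivAt.2
      ⟨fun u => pointwiseApplyCLM T E F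
          ((⟨fderiv ℝ f, hf'.continuous⟩ : C(E, E →L[ℝ] F)).comp u),
        h',
        fun u => hasFDerivAt_continuousMap_comp hf u⟩

end Superposition

section Interval

variable {E F : Type*} [NormedAddCommGroup E] [NormedSpace ℝ E] [NormedAddCommGroup F]
  [NormedSpace ℝ F]

/-- The map `u ↦ (t ↦ (t, u t))` on paths. -/
noncomputable def pathGraph (u : C(I, E)) : C(I, ℝ × E) :=
  ⟨fun t => ((t : ℝ), u t), by fun_prop⟩

theorem hasFDerivAt_pathGraph (u : C(I, E)) :
    HasFDerivAt pathGraph (ContinuousLinearMap.compLeftContinuous ℝ I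
      (ContinuousLinearMap.inr ℝ ℝ E)) u := by
  have h : (pathGraph : C(I, E) → C(I, ℝ × E)) = fun u => pathGraph 0 +
      ContinuousLinearMap.compLeftContinuous ℝ I (ContinuousLinearMap.inr ℝ ℝ E) u := by
    funext u
    ext t <;> simp [pathGraph]
  rw [h]
  exact (ContinuousLinearMap.hasFDerivAt _).const_add _

theorem contDiff_pathGraph : ContDiff ℝ ∞ (pathGraph : C(I, E) → C(I, ℝ × E)) :=
  contDiff_infty.2 fun m => (contDiff_succ_iff_hasFDerivAt.2
    ⟨_, contDiff_const, hasFDerivAt_pathGraph⟩).of_le (by exact_mod_cast Nat.le_succ m)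

/-- The superposition operator `u ↦ (t ↦ f (t, u t))` on paths. -/
noncomputable def superposition {f : ℝ × E → F} (hf : ContDiff ℝ ∞ f) (u : C(I, E)) : C(I, F) :=
  (⟨f, hf.continuous⟩ : C(ℝ × E, F)).comp (pathGraph u)

theorem contDiff_superposition {E F : Type u} [NormedAddCommGroup E] [NormedSpace ℝ E]
    [NormedAddCommGroup F] [NormedSpace ℝ F] {f : ℝ × E → F} (hf : ContDiff ℝ ∞ f) :
    ContDiff ℝ ∞ (superposition hf) :=
  (contDiff_continuousMap_comp hf).comp contDiff_pathGraph

theorem fderiv_superposition_apply {f : ℝ × E → F} (hf : ContDiff ℝ ∞ f) (u h : C(I, E)) (t : I) :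
    fderiv ℝ (superposition hf) u h t = fderiv ℝ f (t, u t) (0, h t) := by
  have := (hasFDerivAt_continuousMap_comp (T := I) hf (pathGraph u)).comp u
    (hasFDerivAt_pathGraph u)
  rw [show superposition hf = _ ∘ pathGraph from rfl, this.fderiv]
  rfl

/-- The Volterra operator `u ↦ (t ↦ ∫₀ᵗ u)`; a path is extended to `ℝ` by constants. -/
noncomputable def volterra (F : Type*) [NormedAddCommGroup F] [NormedSpace ℝ F] :
    C(I, F) →L[ℝ] C(I, F) :=
  LinearMap.mkContinuous
    { toFun := fun u => ⟨fun t => ∫ r in (0 : ℝ)..t, Set.IccExtend zero_le_one u r, by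
        have h : Continuous fun x : ℝ => ∫ r in (0 : ℝ)..x, Set.IccExtend zero_le_one u r :=
          intervalIntegral.continuous_primitive
            (fun a b => (u.continuous.Icc_extend').intervalIntegrable a b) 0
        exact h.comp continuous_subtype_val⟩
      map_add' := fun u v => by
        ext t
        exact intervalIntegral.integral_add ((u.continuous.Icc_extend').intervalIntegrable _ _)
          ((v.continuous.Icc_extend').intervalIntegrable _ _)
      map_smul' := fun c u => by
        ext t
        exact intervalIntegral.integral_smul c _ } 1
    (fun u => by
      refine (ContinuousMap.norm_le _ (by positivity)).2 fun t => ?_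
      have h := intervalIntegral.norm_integral_le_of_norm_le_const (a := 0) (b := t)
        (f := Set.IccExtend zero_le_one u) (C := ‖u‖) fun x _ => u.norm_coe_le_norm _
      rw [one_mul]
      refine h.trans ?_
      rw [sub_zero, abs_of_nonneg t.2.1]
      exact mul_le_of_le_one_right (norm_nonneg _) t.2.2)

theorem volterra_apply (u : C(I, F)) (t : I) :
    volterra F u t = ∫ r in (0 : ℝ)..t, Set.IccExtend zero_le_one u r := rfl

/-- Evaluation of a path at time `t`. -/
noncomputable def pathEval (F : Type*) [NormedAddCommGroup F] [NormedSpace ℝ F] (t : I) :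
    C(I, F) →L[ℝ] F :=
  ContinuousMap.evalCLM ℝ t

/-- The inclusion of constant paths. -/
noncomputable def constPath (E : Type*) [NormedAddCommGroup E] [NormedSpace ℝ E] :
    E →L[ℝ] C(I, E) :=
  LinearMap.mkContinuous
    { toFun := fun x => ContinuousMap.const I x
      map_add' := fun _ _ => rfl
      map_smul' := fun _ _ => rfl } 1
    (fun x => (ContinuousMap.norm_le _ (by positivity)).2 fun _ => (one_mul ‖x‖).ge)

theorem constPath_apply (x : E) (t : I) : constPath E x t = x := rfl

theorem volterra_one_eq (f : ℝ → F) (u : C(I, F)) (h : ∀ t : I, u t = f t) :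
    volterra F u 1 = ∫ t in (0 : ℝ)..1, f t := by
  rw [volterra_apply]
  refine intervalIntegral.integral_congr fun t ht => ?_
  rw [Set.uIcc_of_le (by simp)] at ht
  rw [Set.IccExtend_of_mem _ _ ht, h]

/-- Smoothness of parametric integrals over `[0, 1]`, and differentiation under the integral. -/
theorem contDiff_parametric_integral {E F : Type u} [NormedAddCommGroup E] [NormedSpace ℝ E]
    [NormedAddCommGroup F] [NormedSpace ℝ F] {f : ℝ × E → F} (hf : ContDiff ℝ ∞ f) :
    ContDiff ℝ ∞ (fun x => ∫ t in (0 : ℝ)..1, f (t, x)) ∧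
    ∀ x a, fderiv ℝ (fun x => ∫ t in (0 : ℝ)..1, f (t, x)) x a =
      ∫ t in (0 : ℝ)..1, fderiv ℝ f (t, x) (0, a) := by
  have he : (fun x => ∫ t in (0 : ℝ)..1, f (t, x)) =
      fun x => (pathEval F 1).comp (volterra F) (superposition hf (constPath E x)) := by
    funext x
    exact (volterra_one_eq _ _ fun t => rfl).symm
  have hs : ContDiff ℝ ∞ fun x => superposition hf (constPath E x) :=
    (contDiff_superposition hf).comp (constPath E).contDiff
  rw [he]
  refine ⟨(ContinuousLinearMap.contDiff _).comp hs, fun x a => ?_⟩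
  have h1 : HasFDerivAt (fun x => superposition hf (constPath E x))
      ((fderiv ℝ (superposition hf) (constPath E x)).comp (constPath E)) x :=
    (((contDiff_superposition hf).differentiable (by simp)).differentiableAt.hasFDerivAt).comp x
      (constPath E).hasFDerivAt
  have h2 := (((pathEval F 1).comp (volterra F)).hasFDerivAt.comp x h1).fderiv
  rw [Function.comp_def] at h2
  rw [h2]
  exact volterra_one_eq _ _ fun t => fderiv_superposition_apply hf _ _ t

end Interval

end Analysis

/-! ### Poincaré lemmas -/

section Poincare

open Filter Topology

set_option maxSynthPendingDepth 5

universe u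

/-- A property which holds near the origin holds along the paths `t ↦ h(t, x)`, for `x` near the
origin. -/
theorem eventually_forall_homotopy {E : Type*} [NormedAddCommGroup E] {P : E → Prop}
    (hP : ∀ᶠ x in 𝓝 (0 : E), P x)
    {h : ℝ × E → E} (hh : Continuous h) (h0 : ∀ t, h (t, 0) = 0) :
    ∀ᶠ x in 𝓝 (0 : E), ∀ t ∈ Set.Icc (0 : ℝ) 1, P (h (t, x)) := by
  refine isCompact_Icc.eventually_forall_of_forall_eventually fun t _ => ?_
  have hc : Continuous fun z : E × ℝ => h (z.2, z.1) := by fun_prop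
  have := hc.tendsto (0, t)
  rw [h0] at this
  exact this.eventually hP

variable {E : Type u} [NormedAddCommGroup E] [NormedSpace ℝ E]

/-- The vanishing at `x` of the exterior derivative of a two-form, given as a family of bilinear
maps. -/
def BilinClosedAt (w : E → E →L[ℝ] E →L[ℝ] ℝ) (x : E) : Prop :=
  ∀ a b c, fderiv ℝ w x a b c - fderiv ℝ w x b a c + fderiv ℝ w x c a b = 0

theorem integral_clm_apply_apply {F G : Type*} [NormedAddCommGroup F] [NormedSpace ℝ F]
    [NormedAddCommGroup G] [NormedSpace ℝ G]
    {φ : ℝ → E →L[ℝ] F →L[ℝ] G} (hφ : Continuous φ) (a : E) (b : F) :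
    (∫ t in (0 : ℝ)..1, φ t) a b = ∫ t in (0 : ℝ)..1, φ t a b := by
  rw [ContinuousLinearMap.intervalIntegral_apply (hφ.intervalIntegrable _ _),
    ContinuousLinearMap.intervalIntegral_apply ((by fun_prop : Continuous fun t => φ t a)
      |>.intervalIntegrable _ _)]

/-- The average `∫₀¹ t w(tx) dt` of a smooth map over the segment from the origin to `x`. -/
noncomputable def radialAverage {G : Type*} [NormedAddCommGroup G] [NormedSpace ℝ G] (w : E → G)
    (x : E) : G :=
  ∫ t in (0 : ℝ)..1, t • w (t • x)

theorem contDiff_radialAverage {G : Type u} [NormedAddCommGroup G] [NormedSpace ℝ G] {w : E → G}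
    (hw : ContDiff ℝ ∞ w) :
    ContDiff ℝ ∞ (radialAverage w) ∧ ∀ x a, fderiv ℝ (radialAverage w) x a =
      ∫ t in (0 : ℝ)..1, t ^ 2 • fderiv ℝ w (t • x) a := by
  have hF : ContDiff ℝ ∞ fun z : ℝ × E => z.1 • w (z.1 • z.2) :=
    contDiff_fst.smul (hw.comp (contDiff_fst.smul contDiff_snd))
  have hdF : ∀ t x a, fderiv ℝ (fun z : ℝ × E => z.1 • w (z.1 • z.2)) (t, x) (0, a) =
      t ^ 2 • fderiv ℝ w (t • x) a := by
    intro t x a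
    have h1 : HasFDerivAt (fun y : E => ((t, y) : ℝ × E)) (ContinuousLinearMap.inr ℝ ℝ E) x :=
      hasFDerivAt_prodMk_right t x
    have h2 := ((hF.differentiable (by simp)).differentiableAt (x := (t, x))).hasFDerivAt.comp x h1
    have h3 : HasFDerivAt (fun y : E => t • y) (t • ContinuousLinearMap.id ℝ E) x :=
      (hasFDerivAt_id x).const_smul t
    have h4 : HasFDerivAt w (fderiv ℝ w (t • x)) (t • x) :=
      (hw.differentiable (by simp)).differentiableAt.hasFDerivAt
    have h5 := congrArg (fun A => A a) (h2.unique ((h4.comp x h3).const_smul t))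
    simp only [ContinuousLinearMap.comp_apply, ContinuousLinearMap.inr_apply, _root_.smul_apply,
      ContinuousLinearMap.id_apply, map_smul, smul_smul] at h5
    rw [h5, sq]
  obtain ⟨hI, hdI⟩ := contDiff_parametric_integral hF
  simp only [hdF] at hdI
  exact ⟨hI, hdI⟩

/-- `∫₀¹ d/dt (t² w(tx)) dt = w(x)`. -/
theorem integral_radial_derivative {G : Type*} [NormedAddCommGroup G] [NormedSpace ℝ G]
    [CompleteSpace G] {w : E → G} (hw : ContDiff ℝ ∞ w) (x : E) :
    ∫ t in (0 : ℝ)..1, ((2 * t) • w (t • x) + t ^ 2 • fderiv ℝ w (t • x) x) = w x := by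
  have hc : Continuous fun t : ℝ => fderiv ℝ w (t • x) :=
    (hw.continuous_fderiv (by simp)).comp (by fun_prop)
  have hc' : Continuous fun t : ℝ => w (t • x) := hw.continuous.comp (by fun_prop)
  have hderiv : ∀ t : ℝ, HasDerivAt (fun t : ℝ => t ^ 2 • w (t • x))
      ((2 * t) • w (t • x) + t ^ 2 • fderiv ℝ w (t • x) x) t := by
    intro t
    have h4 : HasFDerivAt w (fderiv ℝ w (t • x)) (t • x) :=
      (hw.differentiable (by simp)).differentiableAt.hasFDerivAt
    have h1 := h4.comp_hasDerivAt t ((hasDerivAt_id t).smul_const x)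
    rw [one_smul] at h1
    refine ((hasDerivAt_pow 2 t).smul h1).congr_deriv ?_
    simp [add_comm]
  have hftc := intervalIntegral.integral_eq_sub_of_hasDerivAt (a := 0) (b := 1)
    (fun t _ => hderiv t) (by apply Continuous.intervalIntegrable; fun_prop)
  rw [hftc]
  simp

/-- Poincaré lemma for two-forms, with the primitive `x ↦ ∫₀¹ t w(tx)(x, ·) dt`, which vanishes to
second order at the origin if `w` vanishes there. -/
theorem exists_primitive_of_closed {w : E → E →L[ℝ] E →L[ℝ] ℝ} (hw : ContDiff ℝ ∞ w)
    (halt : ∀ᶠ x in 𝓝 (0 : E), ∀ a, w x a a = 0)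
    (hcl : ∀ᶠ x in 𝓝 (0 : E), BilinClosedAt w x) (h0 : w 0 = 0) :
    ∃ β : E → E →L[ℝ] ℝ, ContDiff ℝ ∞ β ∧ β 0 = 0 ∧ fderiv ℝ β 0 = 0 ∧
      ∀ᶠ x in 𝓝 (0 : E), ∀ a b, fderiv ℝ β x a b - fderiv ℝ β x b a = w x a b := by
  obtain ⟨hI, hdI⟩ := contDiff_radialAverage hw
  set J := radialAverage w with hJ
  have hβ : ∀ x a b, fderiv ℝ (fun x => J x x) x a b = fderiv ℝ J x a x b + J x a b := by
    intro x a b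
    have hdJ : HasFDerivAt J (fderiv ℝ J x) x :=
      (hI.differentiable (by simp)).differentiableAt.hasFDerivAt
    have h := (hdJ.clm_apply (hasFDerivAt_id x)).fderiv
    simp only [id] at h
    rw [h]
    simp [add_comm]
  have hJ0 : J 0 = 0 := by simp [hJ, radialAverage, h0]
  refine ⟨fun x => J x x, hI.clm_apply contDiff_id, by simp, ?_, ?_⟩
  · ext a b
    rw [hβ, hJ0]
    simp
  have hh : Continuous fun z : ℝ × E => z.1 • z.2 := by fun_prop
  filter_upwards [eventually_forall_homotopy halt hh (by simp),
    eventually_forall_homotopy hcl hh (by simp)] with x hxa hxc a b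
  have hc1 : Continuous fun t : ℝ => w (t • x) := hw.continuous.comp (by fun_prop)
  have hc2 : ∀ c, Continuous fun t : ℝ => fderiv ℝ w (t • x) c := fun c =>
    ((hw.continuous_fderiv (by simp)).comp (by fun_prop : Continuous fun t : ℝ => t • x)).clm_apply
      continuous_const
  have hc3 : ∀ c c' c'', Continuous fun t : ℝ => fderiv ℝ w (t • x) c c' c'' := fun c c' c'' =>
    ((hc2 c).clm_apply continuous_const).clm_apply continuous_const
  have hc4 : ∀ c c', Continuous fun t : ℝ => w (t • x) c c' := fun c c' =>
    (hc1.clm_apply continuous_const).clm_apply continuous_const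
  have e1 : ∀ c c' c'', fderiv ℝ J x c c' c'' =
      ∫ t in (0 : ℝ)..1, t ^ 2 * fderiv ℝ w (t • x) c c' c'' := by
    intro c c' c''
    rw [hdI, integral_clm_apply_apply
      (φ := fun t => t ^ 2 • fderiv ℝ w (t • x) c) ((continuous_id.pow 2).smul (hc2 c))]
    rfl
  have e2 : ∀ c c', J x c c' = ∫ t in (0 : ℝ)..1, t * w (t • x) c c' := by
    intro c c'
    rw [hJ, radialAverage, integral_clm_apply_apply (φ := fun t => t • w (t • x))
      (continuous_id.smul hc1)]
    rfl
  have e3 : w x a b = ∫ t in (0 : ℝ)..1,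
      (2 * t * w (t • x) a b + t ^ 2 * fderiv ℝ w (t • x) x a b) := by
    conv_lhs => rw [← integral_radial_derivative hw x]
    rw [integral_clm_apply_apply
      (φ := fun t => (2 * t) • w (t • x) + t ^ 2 • fderiv ℝ w (t • x) x)
      (((continuous_const.mul continuous_id).smul hc1).add
        ((continuous_id.pow 2).smul (hc2 x)))]
    rfl
  have i3 : ∀ c c' c'', IntervalIntegrable (fun t => t ^ 2 * fderiv ℝ w (t • x) c c' c'')
      MeasureTheory.volume 0 1 := fun c c' c'' =>
    ((continuous_id.pow 2).mul (hc3 c c' c'')).intervalIntegrable _ _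
  have i4 : ∀ c c', IntervalIntegrable (fun t => t * w (t • x) c c')
      MeasureTheory.volume 0 1 := fun c c' => (continuous_id.mul (hc4 c c')).intervalIntegrable _ _
  rw [hβ, hβ, e1, e1, e2, e2, e3, ← intervalIntegral.integral_add (i3 _ _ _) (i4 _ _),
    ← intervalIntegral.integral_add (i3 _ _ _) (i4 _ _),
    ← intervalIntegral.integral_sub ((i3 _ _ _).add (i4 _ _)) ((i3 _ _ _).add (i4 _ _))]
  refine intervalIntegral.integral_congr fun t ht => ?_
  rw [Set.uIcc_of_le zero_le_one] at ht
  have hanti : w (t • x) b a = -w (t • x) a b := by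
    have h1 := hxa t ht (a + b)
    have h2 := hxa t ht a
    have h3 := hxa t ht b
    simp only [map_add, _root_.add_apply, h2, h3] at h1
    linarith
  have hc := hxc t ht x a b
  simp only [hanti]
  linear_combination (-t ^ 2) * hc

/-- Poincaré lemma for one-forms along the fibres of a projection: if `P` is an idempotent and `β`
is closed on the affine subspaces `x + range P`, then there is a function whose differential
agrees with `β` on these subspaces. -/
theorem exists_primitive_along_range {β : E → E →L[ℝ] ℝ} (hβ : ContDiff ℝ ∞ β) {P : E →L[ℝ] E}
    (hP : ∀ v, P (P v) = P v)
    (hcl : ∀ᶠ x in 𝓝 (0 : E), ∀ a b, fderiv ℝ β x (P a) (P b) = fderiv ℝ β x (P b) (P a)) :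
    ∃ f : E → ℝ, ContDiff ℝ ∞ f ∧ ∀ᶠ x in 𝓝 (0 : E), ∀ a, fderiv ℝ f x (P a) = β x (P a) := by
  let h : ℝ × E → E := fun z => z.2 - P z.2 + z.1 • P z.2
  have hh : ContDiff ℝ ∞ h := by fun_prop
  have hF : ContDiff ℝ ∞ fun z : ℝ × E => β (h z) := hβ.comp hh
  have hdβ : ∀ x, HasFDerivAt β (fderiv ℝ β x) x := fun x =>
    (hβ.differentiable (by simp)).differentiableAt.hasFDerivAt
  have hdβc : Continuous (fderiv ℝ β) := hβ.continuous_fderiv (by simp)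
  have hdF : ∀ t x a, fderiv ℝ (fun z : ℝ × E => β (h z)) (t, x) (0, a) =
      fderiv ℝ β (h (t, x)) (a - P a + t • P a) := by
    intro t x a
    have h1 : HasFDerivAt (fun y : E => ((t, y) : ℝ × E)) (ContinuousLinearMap.inr ℝ ℝ E) x :=
      hasFDerivAt_prodMk_right t x
    have h2 := ((hF.differentiable (by simp)).differentiableAt (x := (t, x))).hasFDerivAt.comp x h1
    have h3 : HasFDerivAt (fun y : E => h (t, y)) (ContinuousLinearMap.id ℝ E - P + t • P) x :=
      ((hasFDerivAt_id x).sub P.hasFDerivAt).add (P.hasFDerivAt.const_smul t)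
    exact congrArg (fun A => A a) (h2.unique ((hdβ _).comp x h3))
  obtain ⟨hI, hdI⟩ := contDiff_parametric_integral hF
  simp only [hdF] at hdI
  set J : E → E →L[ℝ] ℝ := fun x => ∫ t in (0 : ℝ)..1, β (h (t, x)) with hJ
  have hdJ : ∀ x, HasFDerivAt J (fderiv ℝ J x) x := fun x =>
    (hI.differentiable (by simp)).differentiableAt.hasFDerivAt
  have hf : ∀ x a, fderiv ℝ (fun x => J x (P x)) x a = fderiv ℝ J x a (P x) + J x (P a) := by
    intro x a
    rw [((hdJ x).clm_apply P.hasFDerivAt).fderiv]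
    simp [add_comm]
  refine ⟨fun x => J x (P x), hI.clm_apply P.contDiff, ?_⟩
  filter_upwards [eventually_forall_homotopy hcl hh.continuous (by simp [h])] with x hx a
  have hc0 : Continuous fun t : ℝ => h (t, x) := by fun_prop
  have hc1 : Continuous fun t : ℝ => β (h (t, x)) := hβ.continuous.comp hc0
  have hc2 : Continuous fun t : ℝ => fderiv ℝ β (h (t, x)) := hdβc.comp hc0
  rw [hf, hdI]
  simp only [hJ, hP, sub_self, zero_add]
  rw [ContinuousLinearMap.intervalIntegral_apply
      (by apply Continuous.intervalIntegrable; fun_prop),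
    ContinuousLinearMap.intervalIntegral_apply
      (by apply Continuous.intervalIntegrable; fun_prop),
    ← intervalIntegral.integral_add (by apply Continuous.intervalIntegrable; fun_prop)
      (by apply Continuous.intervalIntegrable; fun_prop)]
  -- by closedness the integrand is the derivative of `t β(x - Px + tPx)(Pa)`
  have hderiv : ∀ t : ℝ, HasDerivAt (fun t : ℝ => t * β (h (t, x)) (P a))
      (β (h (t, x)) (P a) + t * fderiv ℝ β (h (t, x)) (P x) (P a)) t := by
    intro t
    have h0 : HasDerivAt (fun t : ℝ => h (t, x)) (P x) t := by
      exact (((hasDerivAt_id t).smul_const (P x)).const_add (x - P x)).congr_deriv (one_smul _ _)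
    have h2 := ((hdβ _).comp_hasDerivAt t h0).clm_apply (hasDerivAt_const t (P a))
    exact ((hasDerivAt_id t).mul h2).congr_deriv (by simp)
  have hftc := intervalIntegral.integral_eq_sub_of_hasDerivAt (a := 0) (b := 1)
    (fun t _ => hderiv t) (by apply Continuous.intervalIntegrable; fun_prop)
  have h1x : h (1, x) = x := by simp [h]
  rw [h1x, one_mul, zero_mul, sub_zero] at hftc
  rw [← hftc]
  refine intervalIntegral.integral_congr fun t ht => ?_
  rw [Set.uIcc_of_le zero_le_one] at ht
  simp only [map_smul, _root_.smul_apply, smul_eq_mul]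
  rw [hx t ht a x]
  ring

end Poincare

/-! ### Closed two-forms vanishing on the fibres of a projection -/

section Fibres

open Filter Topology

set_option maxSynthPendingDepth 5

variable {n : ℕ} {B : Type} [NormedAddCommGroup B] [NormedSpace ℝ B]

theorem minSmoothness_two_le_infty : minSmoothness ℝ 2 ≤ ∞ := by
  rw [minSmoothness_of_isRCLikeNormedField]
  exact WithTop.coe_le_coe.2 le_top

theorem sum_smul_single_add (u : (Fin n → ℝ) × B) :
    u = ∑ i, u.1 i • ((Pi.single i 1, 0) : (Fin n → ℝ) × B) + (0, u.2) := by
  ext i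
  · simp [Finset.sum_apply, Pi.single_apply, Prod.fst_sum]
  · simp [Prod.snd_sum]

/-- A closed two-form near the origin of `ℝⁿ × B` whose restriction to the fibres `{x} × B`
vanishes, and which is zero at the origin, is `∑ i, dx_i ∧ dy_i` for functions `y_i` with
vanishing one-jet: subtracting from a primitive `β` a differential `df` which agrees with it on the
fibres gives `-∑ i, y_i dx_i`. -/
theorem exists_eq_sum_dx_wedge_dy {w : (Fin n → ℝ) × B → (Fin n → ℝ) × B →L[ℝ]
      (Fin n → ℝ) × B →L[ℝ] ℝ}
    (hw : ContDiff ℝ ∞ w) (halt : ∀ᶠ z in 𝓝 0, ∀ a, w z a a = 0)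
    (hcl : ∀ᶠ z in 𝓝 0, BilinClosedAt w z) (h0 : w 0 = 0)
    (hfib : ∀ᶠ z in 𝓝 0, ∀ b c : B, w z (0, b) (0, c) = 0) :
    ∃ y : Fin n → (Fin n → ℝ) × B → ℝ, (∀ i, ContDiff ℝ ∞ (y i)) ∧ (∀ i, y i 0 = 0) ∧
      (∀ i, fderiv ℝ (y i) 0 = 0) ∧
      ∀ᶠ z in 𝓝 0, ∀ u v, w z u v =
        ∑ i, (u.1 i * fderiv ℝ (y i) z v - v.1 i * fderiv ℝ (y i) z u) := by
  obtain ⟨β, hβ, -, -, hdβ⟩ := exists_primitive_of_closed hw halt hcl h0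
  let P : (Fin n → ℝ) × B →L[ℝ] (Fin n → ℝ) × B :=
    (ContinuousLinearMap.inr ℝ (Fin n → ℝ) B).comp (ContinuousLinearMap.snd ℝ (Fin n → ℝ) B)
  have hPapply : ∀ u, P u = (0, u.2) := fun u => rfl
  obtain ⟨f, hf, hdf⟩ := exists_primitive_along_range hβ (P := P) (fun v => rfl) (by
    filter_upwards [hdβ, hfib] with z hz hz' a b
    rw [← sub_eq_zero, hz]
    exact hz' _ _)
  let e : Fin n → (Fin n → ℝ) × B := fun i => (Pi.single i 1, 0)
  let γ : (Fin n → ℝ) × B → (Fin n → ℝ) × B →L[ℝ] ℝ := fun z => β z - fderiv ℝ f z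
  have hf' : ContDiff ℝ ∞ (fderiv ℝ f) := hf.fderiv_right (by simp)
  have hγ : ContDiff ℝ ∞ γ := hβ.sub hf'
  have hdiff : ∀ z u v, fderiv ℝ γ z u v - fderiv ℝ γ z v u =
      fderiv ℝ β z u v - fderiv ℝ β z v u := by
    intro z u v
    have h1 : fderiv ℝ γ z = fderiv ℝ β z - fderiv ℝ (fderiv ℝ f) z :=
      fderiv_sub (hβ.differentiable (by simp)).differentiableAt
        (hf'.differentiable (by simp)).differentiableAt
    have h2 := (hf.contDiffAt (x := z)).isSymmSndFDerivAt minSmoothness_two_le_infty u v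
    simp only [h1, _root_.sub_apply, h2]
    ring
  let y : Fin n → (Fin n → ℝ) × B → ℝ := fun i z => -γ z (e i)
  have hy : ∀ i, ContDiff ℝ ∞ (y i) := fun i => (hγ.clm_apply contDiff_const).neg
  have hdy : ∀ i z u, fderiv ℝ (y i) z u = -fderiv ℝ γ z u (e i) := by
    intro i z u
    have h1 : HasFDerivAt γ (fderiv ℝ γ z) z :=
      (hγ.differentiable (by simp)).differentiableAt.hasFDerivAt
    have h2 : fderiv ℝ (y i) z = _ := ((h1.clm_apply (hasFDerivAt_const (e i) z)).neg).fderiv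
    rw [h2]
    simp
  -- `γ` has no component along the fibres
  have hγz : ∀ᶠ z in 𝓝 0, ∀ b : B, γ z (0, b) = 0 := by
    filter_upwards [hdf] with z hz b
    have := hz (0, b)
    rw [hPapply] at this
    simp only [γ, _root_.sub_apply, this, sub_self]
  have hdγ : ∀ᶠ z in 𝓝 0, ∀ u v, fderiv ℝ γ z u v = -∑ i, v.1 i * fderiv ℝ (y i) z u := by
    filter_upwards [hγz.eventually_nhds] with z hz u v
    have h1 : fderiv ℝ γ z u (0, v.2) = 0 := by
      have h2 : (fun z => γ z (0, v.2)) =ᶠ[𝓝 z] fun _ => 0 := hz.mono fun x hx => hx v.2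
      have h3 : HasFDerivAt γ (fderiv ℝ γ z) z :=
        (hγ.differentiable (by simp)).differentiableAt.hasFDerivAt
      have h4 := (h3.clm_apply (hasFDerivAt_const ((0, v.2) : (Fin n → ℝ) × B) z)).unique
        ((hasFDerivAt_const (0 : ℝ) z).congr_of_eventuallyEq h2)
      have h5 := congrArg (fun A => A u) h4
      simpa using h5
    conv_lhs => rw [sum_smul_single_add v]
    rw [map_add, h1, add_zero, map_sum, ← Finset.sum_neg_distrib]
    refine Finset.sum_congr rfl fun i _ => ?_
    rw [hdy, map_smul, smul_eq_mul, mul_neg, neg_neg]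
  have hwy : ∀ᶠ z in 𝓝 0, ∀ u v, w z u v =
      ∑ i, (u.1 i * fderiv ℝ (y i) z v - v.1 i * fderiv ℝ (y i) z u) := by
    filter_upwards [hdβ, hdγ] with z hz hz' u v
    rw [← hz, ← hdiff, hz', hz', Finset.sum_sub_distrib]
    ring
  -- the linear part of `y` at the origin is given by a symmetric matrix, and can be subtracted
  let S : Fin n → Fin n → ℝ := fun i k => fderiv ℝ (y i) 0 (e k)
  have hw0 := hwy.self_of_nhds
  simp only [h0, _root_.zero_apply] at hw0
  have hS : ∀ i k, S i k = S k i := by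
    intro i k
    have h := hw0 (e i) (e k)
    simp only [e, Finset.sum_sub_distrib, Pi.single_apply, ite_mul, one_mul, zero_mul,
      Finset.sum_ite_eq', Finset.mem_univ, if_true] at h
    linarith
  have hfib0 : ∀ i b, fderiv ℝ (y i) 0 ((0, b) : (Fin n → ℝ) × B) = 0 := by
    intro i b
    have h := hw0 (e i) (0, b)
    simp only [e, Pi.single_apply, ite_mul, one_mul, zero_mul, Pi.zero_apply, sub_zero,
      Finset.sum_ite_eq', Finset.mem_univ, if_true] at h
    exact h.symm
  let l : Fin n → (Fin n → ℝ) × B →L[ℝ] ℝ := fun i => ∑ k, S i k •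
    (ContinuousLinearMap.proj (R := ℝ) (φ := fun _ : Fin n => ℝ) k).comp
      (ContinuousLinearMap.fst ℝ (Fin n → ℝ) B)
  have hl : ∀ i u, l i u = ∑ k, S i k * u.1 k := by
    intro i u
    simp [l]
  have hdy' : ∀ i z, fderiv ℝ (fun z => y i z - y i 0 - l i z) z = fderiv ℝ (y i) z - l i := by
    intro i z
    have h1 : HasFDerivAt (y i) (fderiv ℝ (y i) z) z :=
      ((hy i).differentiable (by simp)).differentiableAt.hasFDerivAt
    exact ((h1.sub_const (y i 0)).sub (l i).hasFDerivAt).fderiv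
  refine ⟨fun i z => y i z - y i 0 - l i z, fun i => ((hy i).sub contDiff_const).sub (l i).contDiff,
    fun i => by simp, fun i => ?_, ?_⟩
  · refine ContinuousLinearMap.ext fun u => ?_
    rw [hdy', _root_.sub_apply, hl, _root_.zero_apply]
    conv_lhs => enter [1]; rw [sum_smul_single_add u]
    rw [map_add, hfib0, add_zero, map_sum, ← Finset.sum_sub_distrib]
    refine Finset.sum_eq_zero fun k _ => ?_
    rw [map_smul, smul_eq_mul]
    simp only [S, e]
    ring
  · filter_upwards [hwy] with z hz u v
    have hsym : ∑ i, u.1 i * l i v = ∑ i, v.1 i * l i u := by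
      simp only [hl, Finset.mul_sum]
      rw [Finset.sum_comm]
      refine Finset.sum_congr rfl fun i _ => Finset.sum_congr rfl fun k _ => ?_
      rw [hS]
      ring
    rw [hz]
    simp only [hdy', _root_.sub_apply, mul_sub, Finset.sum_sub_distrib, hsym]
    ring

end Fibres

/-! ### Moser's method -/

section Moser

open Filter Topology unitInterval

set_option maxSynthPendingDepth 5

universe u

theorem eventually_fderiv_isInvertible {E F : Type*} [NormedAddCommGroup E] [NormedSpace ℝ E]
    [NormedAddCommGroup F] [NormedSpace ℝ F] [CompleteSpace E] {f : E → F} {x₀ : E}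
    (hf : ContDiffAt ℝ ∞ f x₀) (hinv : (fderiv ℝ f x₀).IsInvertible) :
    ∀ᶠ x in 𝓝 x₀, (fderiv ℝ f x).IsInvertible := by
  have hc : ContinuousAt (fderiv ℝ f) x₀ :=
    (hf.fderiv_right (m := 0) (by simp)).continuousAt
  obtain ⟨M, hM⟩ := hinv
  have h := M.nhds
  rw [hM] at h
  filter_upwards [hc h] with x hx
  exact hx

/-- Inverse function theorem for maps which are smooth near a point: the local inverse can be
chosen to be smooth on its whole domain, and its image inside a given neighbourhood. -/
theorem exists_smooth_openPartialHomeomorph {E F : Type*} [NormedAddCommGroup E] [NormedSpace ℝ E]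
    [NormedAddCommGroup F] [NormedSpace ℝ F] [CompleteSpace E] {f : E → F} {x₀ : E}
    (hf : ∀ᶠ x in 𝓝 x₀, ContDiffAt ℝ ∞ f x) (hinv : (fderiv ℝ f x₀).IsInvertible)
    {P : E → Prop} (hP : ∀ᶠ x in 𝓝 x₀, P x) :
    ∃ R : OpenPartialHomeomorph E F, ⇑R = f ∧ x₀ ∈ R.source ∧
      (∀ x ∈ R.source, ContDiffAt ℝ ∞ f x ∧ P x) ∧ ∀ y ∈ R.target, ContDiffAt ℝ ∞ R.symm y := by
  obtain ⟨O, hO, hOo, hx₀⟩ := eventually_nhds_iff.1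
    ((hf.and hP).and (eventually_fderiv_isInvertible hf.self_of_nhds hinv))
  obtain ⟨M, hM⟩ := hinv
  have hd : HasFDerivAt f (M : E →L[ℝ] F) x₀ := by
    rw [hM]
    exact (hf.self_of_nhds.differentiableAt (by simp)).hasFDerivAt
  let R₀ := hf.self_of_nhds.toOpenPartialHomeomorph f hd (by simp)
  have hsrc : ∀ x ∈ (R₀.restrOpen O hOo).source, x ∈ O := fun x hx => hx.2
  refine ⟨R₀.restrOpen O hOo, rfl,
    ⟨hf.self_of_nhds.mem_toOpenPartialHomeomorph_source hd (by simp), hx₀⟩,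
    fun x hx => (hO x (hsrc x hx)).1, fun y hy => ?_⟩
  have hy' := hO _ (hsrc _ ((R₀.restrOpen O hOo).map_target hy))
  obtain ⟨N, hN⟩ := hy'.2
  refine OpenPartialHomeomorph.contDiffAt_symm _ (f₀' := N) hy ?_ hy'.1.1
  rw [hN]
  exact (hy'.1.1.differentiableAt (by simp)).hasFDerivAt

/-- Solutions of the integral equation `u(t) = x + ∫₀ᵗ v` extend to differentiable functions. -/
theorem exists_hasDerivAt_of_volterra {E : Type*} [NormedAddCommGroup E] [NormedSpace ℝ E]
    [CompleteSpace E] {u v : C(I, E)} {x : E} (h : u - volterra E v = constPath E x) :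
    ∃ U : ℝ → E, (∀ t : I, U t = u t) ∧ U 0 = x ∧ ∀ t : I, HasDerivAt U (v t) t := by
  have hc : Continuous (Set.IccExtend (zero_le_one (α := ℝ)) v) := v.continuous.Icc_extend'
  refine ⟨fun t => x + ∫ r in (0 : ℝ)..t, Set.IccExtend zero_le_one v r, fun t => ?_, by simp,
    fun t => ?_⟩
  · have := congrArg (fun p : C(I, E) => p t) h
    simp only [ContinuousMap.sub_apply, constPath_apply, volterra_apply] at this
    rw [← this]
    exact sub_add_cancel _ _
  · have := (hc.integral_hasStrictDerivAt 0 (t : ℝ)).hasDerivAt.const_add x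
    rwa [Set.IccExtend_val] at this

/-- The flow up to time one of a time-dependent vector field `g` on `[0, 1]` which vanishes to
second order at the origin. The path `U x` solves `u' = g(t, u)` with `u(0) = x`, and its
derivative solves the variational equation. As `u ↦ u - ∫ g(t, u)` is a smooth map of the
space of paths with derivative the identity at the zero path, `U` is given by the inverse function
theorem. -/
theorem exists_smooth_flow {E : Type u} [NormedAddCommGroup E] [NormedSpace ℝ E] [CompleteSpace E]
    {g : ℝ × E → E} (hg : ContDiff ℝ ∞ g) (h0 : ∀ t : I, g (t, 0) = 0)
    (hd0 : ∀ (t : I) (a : E), fderiv ℝ g (t, 0) (0, a) = 0) :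
    ∃ U : E → C(I, E), U 0 = 0 ∧ fderiv ℝ U 0 = constPath E ∧
      (∀ᶠ x in 𝓝 0, ContDiffAt ℝ ∞ U x) ∧
      (∀ᶠ x in 𝓝 0, U x - volterra E (superposition hg (U x)) = constPath E x) ∧
      ∀ᶠ x in 𝓝 0, ∀ a, fderiv ℝ U x a - volterra E (fderiv ℝ (superposition hg) (U x)
        (fderiv ℝ U x a)) = constPath E a := by
  let H : C(I, E) → C(I, E) := fun u => u - volterra E (superposition hg u)
  have hH : ContDiff ℝ ∞ H :=
    contDiff_id.sub ((volterra E).contDiff.comp (contDiff_superposition hg))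
  have hdH : ∀ u, HasFDerivAt H (ContinuousLinearMap.id ℝ C(I, E) -
      (volterra E).comp (fderiv ℝ (superposition hg) u)) u := fun u =>
    (hasFDerivAt_id u).sub ((volterra E).hasFDerivAt.comp u
      ((contDiff_superposition hg).differentiable (by simp)).differentiableAt.hasFDerivAt)
  have hs0 : superposition hg 0 = 0 := by
    ext t
    exact h0 t
  have hds0 : fderiv ℝ (superposition hg) (0 : C(I, E)) = 0 := by
    ext h t
    rw [fderiv_superposition_apply]
    exact hd0 t _
  have hH0 : H 0 = 0 := by simp [H, hs0]
  have hdH0 : fderiv ℝ H 0 = ContinuousLinearMap.id ℝ C(I, E) := by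
    rw [(hdH 0).fderiv, hds0, ContinuousLinearMap.comp_zero, sub_zero]
  obtain ⟨R, hRH, hR0, -, hRs⟩ := exists_smooth_openPartialHomeomorph (x₀ := (0 : C(I, E)))
    (Eventually.of_forall fun u => hH.contDiffAt)
    (by rw [hdH0]; exact ⟨ContinuousLinearEquiv.refl ℝ _, rfl⟩)
    (P := fun _ => True) (Eventually.of_forall fun _ => trivial)
  have h0t : (0 : C(I, E)) ∈ R.target := by
    have := R.map_source hR0
    rwa [hRH, hH0] at this
  let U : E → C(I, E) := fun x => R.symm (constPath E x)
  have hU0 : U 0 = 0 := by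
    have := R.left_inv hR0
    rw [hRH, hH0] at this
    simp only [U, map_zero, this]
  have htgt : ∀ᶠ x in 𝓝 (0 : E), constPath E x ∈ R.target := by
    have := (constPath E).continuous.tendsto 0
    rw [map_zero] at this
    exact this.eventually (R.open_target.mem_nhds h0t)
  have hUs : ∀ᶠ x in 𝓝 (0 : E), ContDiffAt ℝ ∞ U x := by
    filter_upwards [htgt] with x hx
    exact (hRs _ hx).comp x (constPath E).contDiff.contDiffAt
  have hHU : ∀ᶠ x in 𝓝 (0 : E), H (U x) = constPath E x := by
    filter_upwards [htgt] with x hx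
    rw [← hRH]
    exact R.right_inv hx
  have hvar : ∀ᶠ x in 𝓝 (0 : E), ∀ a, fderiv ℝ U x a -
      volterra E (fderiv ℝ (superposition hg) (U x) (fderiv ℝ U x a)) = constPath E a := by
    filter_upwards [hUs, hHU.eventually_nhds] with x hx hx' a
    have h1 := (hdH (U x)).comp x (hx.differentiableAt (by simp)).hasFDerivAt
    have h2 := h1.unique ((constPath E).hasFDerivAt.congr_of_eventuallyEq hx')
    exact congrArg (fun A => A a) h2
  refine ⟨U, hU0, ?_, hUs, hHU, hvar⟩
  have h := hvar.self_of_nhds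
  rw [hU0, hds0] at h
  refine ContinuousLinearMap.ext fun a => ?_
  have h' := h a
  rwa [_root_.zero_apply, map_zero, sub_zero] at h'

variable {E : Type u} [NormedAddCommGroup E] [NormedSpace ℝ E] [FiniteDimensional ℝ E]

/-- Darboux theorem by Moser's method. With `dβ = w(0) - w` and `w_t = w + t (w(0) - w)`, the
vector field `X_t` with `w_t(X_t, ·) = -β` vanishes to second order at the origin, and its flow
pulls `w_t` back to `w`. -/
theorem exists_darboux {w : E → E →L[ℝ] E →L[ℝ] ℝ} (hw : ContDiff ℝ ∞ w)
    (halt : ∀ᶠ x in 𝓝 (0 : E), ∀ a, w x a a = 0)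
    (hcl : ∀ᶠ x in 𝓝 (0 : E), BilinClosedAt w x) (hinv : (w 0).IsInvertible) :
    ∃ Ψ : E → E, Ψ 0 = 0 ∧ fderiv ℝ Ψ 0 = ContinuousLinearMap.id ℝ E ∧
      (∀ᶠ x in 𝓝 0, ContDiffAt ℝ ∞ Ψ x) ∧
      ∀ᶠ x in 𝓝 0, ∀ a b, w 0 (fderiv ℝ Ψ x a) (fderiv ℝ Ψ x b) = w x a b := by
  have hdw : ∀ x, HasFDerivAt w (fderiv ℝ w x) x := fun x =>
    (hw.differentiable (by simp)).differentiableAt.hasFDerivAt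
  obtain ⟨β, hβ, hβ0, hdβ0, hdβ⟩ := exists_primitive_of_closed (w := fun x => w 0 - w x)
    (contDiff_const.sub hw) (by
      filter_upwards [halt] with x hx a
      rw [_root_.sub_apply, _root_.sub_apply, halt.self_of_nhds, hx, sub_zero]) (by
      filter_upwards [hcl] with x hx a b c
      have : fderiv ℝ (fun x => w 0 - w x) x = -fderiv ℝ w x := ((hdw x).const_sub (w 0)).fderiv
      have := hx a b c
      simp only [*, _root_.neg_apply]
      linarith) (sub_self _)
  have hdβ' : ∀ x, HasFDerivAt β (fderiv ℝ β x) x := fun x =>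
    (hβ.differentiable (by simp)).differentiableAt.hasFDerivAt
  let W : ℝ × E → E →L[ℝ] E →L[ℝ] ℝ := fun z => w z.2 + z.1 • (w 0 - w z.2)
  have hW : ContDiff ℝ ∞ W := (hw.comp contDiff_snd).add
    (contDiff_fst.smul (contDiff_const.sub (hw.comp contDiff_snd)))
  have hW0 : ∀ t, W (t, 0) = w 0 := fun t => by simp [W]
  let K : Set (ℝ × E) := Set.Icc 0 1 ×ˢ {0}
  have hK : IsCompact K := isCompact_Icc.prod isCompact_singleton
  -- the vector field, cut off away from `[0, 1] × {0}`
  let X : ℝ × E → E := fun z => -(W z).inverse (β z.2)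
  have hWinv : ∀ᶠ z in 𝓝ˢ K, (W z).IsInvertible := by
    have hopen : IsOpen {z | (W z).IsInvertible} :=
      (ContinuousLinearEquiv.isOpen (𝕜 := ℝ) (E := E) (F := E →L[ℝ] ℝ)).preimage hW.continuous
    refine hopen.mem_nhdsSet.2 ?_
    rintro ⟨t, x⟩ ⟨-, rfl⟩
    change (W (t, 0)).IsInvertible
    rw [hW0]
    exact hinv
  have hX : ∀ᶠ z in 𝓝ˢ K, ContDiffAt ℝ ∞ X z := by
    filter_upwards [hWinv] with z hz
    exact ((hz.contDiffAt_map_inverse.comp z hW.contDiffAt).clm_apply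
      (hβ.comp contDiff_snd).contDiffAt).neg
  obtain ⟨g, hg, hgX⟩ := exists_contDiff_eventuallyEq_nhdsSet hK.isClosed hX
  have hgW : ∀ᶠ z in 𝓝ˢ K, W z (g z) = -β z.2 := by
    filter_upwards [hWinv, hgX] with z hz hz'
    obtain ⟨M, hM⟩ := hz
    rw [hz']
    simp only [X, ← hM, ContinuousLinearMap.inverse_equiv, map_neg]
    simp
  have hdW : ∀ t x, HasFDerivAt (fun y => W (t, y)) ((1 - t) • fderiv ℝ w x) x := by
    intro t x
    refine ((hdw x).add (((hdw x).const_sub (w 0)).const_smul t)).congr_fderiv ?_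
    module
  have hdg : ∀ t x, HasFDerivAt (fun y => g (t, y))
      ((fderiv ℝ g (t, x)).comp (ContinuousLinearMap.inr ℝ ℝ E)) x := fun t x =>
    ((hg.differentiable (by simp)).differentiableAt (x := (t, x))).hasFDerivAt.comp x
      (hasFDerivAt_prodMk_right t x)
  have hvar : ∀ᶠ z in 𝓝ˢ K, ∀ a b, (1 - z.1) * fderiv ℝ w z.2 a (g z) b +
      W z (fderiv ℝ g z (0, a)) b + fderiv ℝ β z.2 a b = 0 := by
    rw [eventually_nhdsSet_iff_exists] at hgW ⊢
    obtain ⟨O, hO, hKO, hOg⟩ := hgW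
    refine ⟨O, hO, hKO, ?_⟩
    rintro ⟨t, x⟩ hz a b
    have h1 := (((hdW t x).clm_apply (hdg t x)).add (hdβ' x))
    have h2 : (fun y => W (t, y) (g (t, y)) + β y) =ᶠ[𝓝 x] fun _ => 0 := by
      have hc : ContinuousAt (fun y : E => ((t, y) : ℝ × E)) x := by fun_prop
      filter_upwards [hc (hO.mem_nhds hz)] with y hy
      rw [hOg _ hy, neg_add_cancel]
    have h3 := h1.unique ((hasFDerivAt_const (0 : E →L[ℝ] ℝ) x).congr_of_eventuallyEq h2)
    have h4 := congrArg (fun A => A a b) h3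
    simp only [_root_.add_apply, ContinuousLinearMap.comp_apply, ContinuousLinearMap.flip_apply,
      _root_.smul_apply, smul_eq_mul, _root_.zero_apply, ContinuousLinearMap.inr_apply] at h4
    linarith
  have hmemK : ∀ t : I, ((t : ℝ), (0 : E)) ∈ K := fun t => ⟨t.2, rfl⟩
  have hinj : ∀ a, w 0 a = 0 → a = 0 := by
    obtain ⟨M, hM⟩ := hinv
    intro a ha
    rw [← hM] at ha
    exact (map_eq_zero_iff M M.injective).1 ha
  have hg0 : ∀ t : I, g (t, 0) = 0 := fun t => hinj _ (by
    rw [← hW0 t, hgW.self_of_nhdsSet _ (hmemK t), hβ0, neg_zero])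
  have hdg0 : ∀ (t : I) (a : E), fderiv ℝ g (t, 0) (0, a) = 0 := fun t a => hinj _ (by
    ext b
    have h := hvar.self_of_nhdsSet _ (hmemK t) a b
    simpa [hg0, hdβ0, hW0] using h)
  obtain ⟨U, hU0, hdU0, hUs, hUeq, hUvar⟩ := exists_smooth_flow hg hg0 hdg0
  let Ψ : E → E := fun x => pathEval E 1 (U x)
  have hdΨ : ∀ x, ContDiffAt ℝ ∞ U x → fderiv ℝ Ψ x = (pathEval E 1).comp (fderiv ℝ U x) :=
    fun x hx =>
      ((pathEval E 1).hasFDerivAt.comp x (hx.differentiableAt (by simp)).hasFDerivAt).fderiv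
  -- paths starting near the origin stay in the region where all identities hold
  have hall : ∀ᶠ x in 𝓝 (0 : E), ∀ t : I, (∀ a, w (U x t) a a = 0) ∧ BilinClosedAt w (U x t) ∧
      (∀ a b, fderiv ℝ β (U x t) a b - fderiv ℝ β (U x t) b a = w 0 a b - w (U x t) a b) ∧
      ∀ a b, (1 - (t : ℝ)) * fderiv ℝ w (U x t) a (g (t, U x t)) b +
        W (t, U x t) (fderiv ℝ g (t, U x t) (0, a)) b + fderiv ℝ β (U x t) a b = 0 := by
    have h1 : ∀ᶠ y in 𝓝 (0 : E), ∀ t ∈ (Set.univ : Set I), (∀ a, w y a a = 0) ∧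
        BilinClosedAt w y ∧ (∀ a b, fderiv ℝ β y a b - fderiv ℝ β y b a = w 0 a b - w y a b) ∧
        ∀ a b, (1 - (t : ℝ)) * fderiv ℝ w y a (g (t, y)) b +
          W (t, y) (fderiv ℝ g (t, y) (0, a)) b + fderiv ℝ β y a b = 0 := by
      refine isCompact_univ.eventually_forall_of_forall_eventually fun t _ => ?_
      have hc1 : Tendsto (fun z : E × I => z.1) (𝓝 (0, t)) (𝓝 0) := continuous_fst.tendsto _
      have hc2 : Tendsto (fun z : E × I => ((z.2 : ℝ), z.1)) (𝓝 (0, t)) (𝓝 ((t : ℝ), 0)) :=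
        (by fun_prop : Continuous fun z : E × I => ((z.2 : ℝ), z.1)).tendsto _
      filter_upwards [hc1.eventually halt, hc1.eventually hcl, hc1.eventually hdβ,
        hc2.eventually (hvar.filter_mono (nhds_le_nhdsSet (hmemK t)))] with z e1 e2 e3 e4
      exact ⟨e1, e2, e3, e4⟩
    obtain ⟨δ, hδ, hb⟩ := Metric.eventually_nhds_iff_ball.1 h1
    have hUc : ContinuousAt U 0 := hUs.self_of_nhds.continuousAt
    rw [ContinuousAt, hU0] at hUc
    filter_upwards [hUc.eventually (Metric.ball_mem_nhds 0 hδ)] with x hx t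
    refine hb _ ?_ t (Set.mem_univ t)
    rw [dist_zero_right] at hx
    rw [mem_ball_zero_iff]
    exact ((U x).norm_coe_le_norm t).trans_lt hx
  refine ⟨Ψ, by simp only [Ψ, hU0, map_zero], ?_, ?_, ?_⟩
  · rw [hdΨ 0 hUs.self_of_nhds, hdU0]
    rfl
  · filter_upwards [hUs] with x hx
    exact (pathEval E 1).contDiff.contDiffAt.comp x hx
  filter_upwards [hUs, hUeq, hUvar, hall] with x hx hxe hxv hxa a b
  rw [hdΨ x hx]
  obtain ⟨u, hu, hu0, hdu⟩ := exists_hasDerivAt_of_volterra hxe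
  obtain ⟨A, hA, hA0, hdA⟩ := exists_hasDerivAt_of_volterra (hxv a)
  obtain ⟨B, hB, hB0, hdB⟩ := exists_hasDerivAt_of_volterra (hxv b)
  -- the pullback of `w_t` by the flow is constant in time
  have hderiv : ∀ t ∈ Set.Icc (0 : ℝ) 1, HasDerivAt (fun t => W (t, u t) (A t) (B t)) 0 t := by
    intro t ht
    obtain ⟨t, rfl⟩ : ∃ s : I, (s : ℝ) = t := ⟨⟨t, ht⟩, rfl⟩
    have d1 := hdu t
    have d2 := hdA t
    have d3 := hdB t
    rw [fderiv_superposition_apply, ← hA] at d2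
    rw [fderiv_superposition_apply, ← hB] at d3
    obtain ⟨e1, e2, e3, e4⟩ := hxa t
    change HasDerivAt u (g (t, U x t)) t at d1
    rw [← hu] at d1 d2 d3 e1 e2 e3 e4
    have d4 := (hdw (u t)).comp_hasDerivAt (t : ℝ) d1
    have d5 := d4.add ((hasDerivAt_id (t : ℝ)).smul (d4.const_sub (w 0)))
    have d6 := (d5.clm_apply d2).clm_apply d3
    refine d6.congr_deriv ?_
    have hanti : ∀ c d, W (t, u t) c d = -W (t, u t) d c := by
      have hW' : ∀ c, W (t, u t) c c = 0 := by
        intro c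
        have h1 := halt.self_of_nhds c
        have h2 := e1 c
        simp only [W, _root_.add_apply, _root_.smul_apply, _root_.sub_apply, h1, h2, sub_zero,
          smul_zero, add_zero]
      intro c d
      have h1 := hW' (c + d)
      have h2 := hW' c
      have h3 := hW' d
      simp only [map_add, _root_.add_apply, h2, h3] at h1
      linarith
    have r1 := e4 (A t) (B t)
    have r2 := e4 (B t) (A t)
    have r3 := e2 (g (t, u t)) (A t) (B t)
    have r4 := e3 (A t) (B t)
    have r5 := hanti (A t) (fderiv ℝ g (t, u t) (0, B t))
    simp only [W, _root_.add_apply, _root_.smul_apply, _root_.sub_apply, smul_eq_mul] at r1 r2 r5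
    simp only [_root_.add_apply, _root_.smul_apply, _root_.sub_apply, _root_.neg_apply, smul_eq_mul,
      Function.comp_apply, id, one_mul, Pi.add_apply, Pi.smul_apply']
    linear_combination r1 - r2 - r4 + r5 + (1 - (t : ℝ)) * r3
  have hconst := constant_of_has_deriv_right_zero
    (fun t ht => (hderiv t ht).continuousAt.continuousWithinAt)
    (fun t ht => (hderiv t (Set.Ico_subset_Icc_self ht)).hasDerivWithinAt) 1 (by simp)
  have e1 := hA 1
  have e2 := hB 1
  simp only [Set.Icc.coe_one] at e1 e2
  simp only [hu0, hA0, hB0, e1, e2, W, one_smul, zero_smul, add_zero, add_sub_cancel] at hconst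
  exact hconst

end Moser

/-! ### The normal form on the coordinate space -/

section NormalForm

open Filter Topology

set_option maxSynthPendingDepth 5

theorem isInvertible_of_injective {E F : Type*} [NormedAddCommGroup E] [NormedSpace ℝ E]
    [FiniteDimensional ℝ E] [NormedAddCommGroup F] [NormedSpace ℝ F] [FiniteDimensional ℝ F]
    {A : E →L[ℝ] F} (hA : ∀ a, A a = 0 → a = 0)
    (hd : Module.finrank ℝ E = Module.finrank ℝ F) : A.IsInvertible :=
  ⟨(LinearMap.linearEquivOfInjective A.toLinearMap
      ((injective_iff_map_eq_zero A).2 hA) hd).toContinuousLinearEquiv, by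
    ext a
    rfl⟩

/-- The coordinate `x_i` of `ℝ^{n(s+1)}`. -/
noncomputable def polyX (n s : ℕ) (i : Fin n) : PolyCoord n s →L[ℝ] ℝ :=
  (ContinuousLinearMap.proj (R := ℝ) (φ := fun _ : Fin n => ℝ) i).comp
    (ContinuousLinearMap.fst ℝ (Fin n → ℝ) (Fin s → Fin n → ℝ))

/-- The coordinate `y^j_i` of `ℝ^{n(s+1)}`. -/
noncomputable def polyY (n s : ℕ) (j : Fin s) (i : Fin n) : PolyCoord n s →L[ℝ] ℝ :=
  (ContinuousLinearMap.proj (R := ℝ) (φ := fun _ : Fin n => ℝ) i).comp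
    ((ContinuousLinearMap.proj (R := ℝ) (φ := fun _ : Fin s => Fin n → ℝ) j).comp
      (ContinuousLinearMap.snd ℝ (Fin n → ℝ) (Fin s → Fin n → ℝ)))

@[simp] theorem polyX_apply {n s : ℕ} (i : Fin n) (u : PolyCoord n s) : polyX n s i u = u.1 i :=
  rfl

@[simp] theorem polyY_apply {n s : ℕ} (j : Fin s) (i : Fin n) (u : PolyCoord n s) :
    polyY n s j i u = u.2 j i :=
  rfl

/-- The standard form `∑ i, dx_i ∧ dy^j_i` as a bilinear form. -/
noncomputable def stdBilin (n s : ℕ) (j : Fin s) :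
    PolyCoord n s →L[ℝ] PolyCoord n s →L[ℝ] ℝ :=
  ∑ i, ((polyX n s i).smulRight (polyY n s j i) - (polyY n s j i).smulRight (polyX n s i))

theorem stdBilin_apply {n s : ℕ} (j : Fin s) (u v : PolyCoord n s) :
    stdBilin n s j u v = ∑ i, (u.1 i * v.2 j i - v.1 i * u.2 j i) := by
  simp only [stdBilin, _root_.sum_apply, _root_.sub_apply, ContinuousLinearMap.smulRight_apply,
    _root_.smul_apply, smul_eq_mul, polyX_apply, polyY_apply]
  exact Finset.sum_congr rfl fun i _ => by ring

theorem stdBilin_one_isInvertible (n : ℕ) : (stdBilin n 1 0).IsInvertible := by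
  refine isInvertible_of_injective (fun a ha => ?_) ?_
  · have h1 : ∀ b : PolyCoord n 1, ∑ i, (a.1 i * b.2 0 i - b.1 i * a.2 0 i) = 0 := fun b => by
      rw [← stdBilin_apply, ha, _root_.zero_apply]
    ext i j
    · simpa [Pi.single_apply] using h1 (0, fun _ => Pi.single i 1)
    · obtain rfl := Subsingleton.elim i 0
      simpa [Pi.single_apply] using h1 (Pi.single j 1, 0)
  · rw [← (LinearMap.toContinuousLinearMap :
      (PolyCoord n 1 →ₗ[ℝ] ℝ) ≃ₗ[ℝ] (PolyCoord n 1 →L[ℝ] ℝ)).finrank_eq]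
    exact Subspace.dual_finrank_eq.symm

/-- Closed two-forms near the origin of `ℝ^{n(s+1)}` which have the standard values at the origin
are brought into the standard form by a map which is tangent to the identity, provided that for
`s ≥ 2` they vanish on the fibres of the projection to the coordinates `x`. -/
theorem exists_map_to_stdBilin {n s : ℕ} (hs : 1 ≤ s)
    {w : Fin s → PolyCoord n s → PolyCoord n s →L[ℝ] PolyCoord n s →L[ℝ] ℝ}
    (hw : ∀ j, ContDiff ℝ ∞ (w j)) (halt : ∀ j, ∀ᶠ z in 𝓝 0, ∀ a, w j z a a = 0)
    (hcl : ∀ j, ∀ᶠ z in 𝓝 0, BilinClosedAt (w j) z) (h0 : ∀ j, w j 0 = stdBilin n s j)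
    (hfib : 2 ≤ s → ∀ j, ∀ᶠ z in 𝓝 0, ∀ b c : Fin s → Fin n → ℝ, w j z (0, b) (0, c) = 0) :
    ∃ Ψ : PolyCoord n s → PolyCoord n s, Ψ 0 = 0 ∧
      fderiv ℝ Ψ 0 = ContinuousLinearMap.id ℝ (PolyCoord n s) ∧
      (∀ᶠ z in 𝓝 0, ContDiffAt ℝ ∞ Ψ z) ∧
      ∀ᶠ z in 𝓝 0, ∀ j a b, stdBilin n s j (fderiv ℝ Ψ z a) (fderiv ℝ Ψ z b) = w j z a b := by
  obtain rfl | hs2 := hs.eq_or_lt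
  · obtain ⟨Ψ, h1, h2, h3, h4⟩ := exists_darboux (hw 0) (halt 0) (hcl 0)
      (by rw [h0]; exact stdBilin_one_isInvertible n)
    refine ⟨Ψ, h1, h2, h3, ?_⟩
    filter_upwards [h4] with z hz j
    obtain rfl := Subsingleton.elim j 0
    rwa [h0] at hz
  have hex : ∀ j, ∃ y : Fin n → PolyCoord n s → ℝ, (∀ i, ContDiff ℝ ∞ (y i)) ∧
      (∀ i, y i 0 = 0) ∧ (∀ i, fderiv ℝ (y i) 0 = 0) ∧
      ∀ᶠ z in 𝓝 0, ∀ u v, w j z u v - stdBilin n s j u v =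
        ∑ i, (u.1 i * fderiv ℝ (y i) z v - v.1 i * fderiv ℝ (y i) z u) := by
    intro j
    refine exists_eq_sum_dx_wedge_dy (w := fun z => w j z - stdBilin n s j)
      ((hw j).sub contDiff_const) ?_ ?_ (by simp only [h0, sub_self]) ?_
    · filter_upwards [halt j] with z hz a
      rw [_root_.sub_apply, _root_.sub_apply, hz, stdBilin_apply]
      simp
    · filter_upwards [hcl j] with z hz a b c
      have h : fderiv ℝ (fun z => w j z - stdBilin n s j) z = fderiv ℝ (w j) z :=
        fderiv_sub_const _
      rw [h]
      exact hz a b c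
    · filter_upwards [hfib hs2 j] with z hz b c
      rw [_root_.sub_apply, _root_.sub_apply, hz, stdBilin_apply]
      simp
  choose y hy hy0 hdy0 hwy using hex
  let Ψ : PolyCoord n s → PolyCoord n s := fun z => (z.1, fun j i => z.2 j i + y j i z)
  have hdΨ : ∀ z, HasFDerivAt Ψ ((ContinuousLinearMap.fst ℝ _ _).prod
      (ContinuousLinearMap.pi fun j => ContinuousLinearMap.pi fun i =>
        polyY n s j i + fderiv ℝ (y j i) z)) z := by
    intro z
    refine hasFDerivAt_fst.prodMk (hasFDerivAt_pi.2 fun j => hasFDerivAt_pi.2 fun i => ?_)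
    exact (polyY n s j i).hasFDerivAt.add
      ((hy j i).differentiable (by simp)).differentiableAt.hasFDerivAt
  refine ⟨Ψ, ?_, ?_, Eventually.of_forall fun z => ContDiff.contDiffAt ?_, ?_⟩
  · ext <;> simp [Ψ, hy0]
  · rw [(hdΨ 0).fderiv]
    refine ContinuousLinearMap.ext fun a => ?_
    ext <;> simp [hdy0]
  · exact contDiff_fst.prodMk (contDiff_pi.2 fun j => contDiff_pi.2 fun i =>
      (polyY n s j i).contDiff.add (hy j i))
  · filter_upwards [eventually_all.2 hwy] with z hz j a b
    rw [← sub_add_cancel (w j z a b) (stdBilin n s j a b), hz, (hdΨ z).fderiv, stdBilin_apply,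
      stdBilin_apply, ← Finset.sum_add_distrib]
    refine Finset.sum_congr rfl fun i _ => ?_
    simp only [ContinuousLinearMap.prod_apply, ContinuousLinearMap.pi_apply, _root_.add_apply,
      polyY_apply, ContinuousLinearMap.coe_fst']
    ring

end NormalForm

/-! ### Coordinates adapted to forms on a vector space -/

section Coordinates

open Filter Topology

set_option maxSynthPendingDepth 5

section

variable {E : Type*} [NormedAddCommGroup E] [NormedSpace ℝ E]

/-- Alternating two-forms as bilinear maps. -/
noncomputable def formToBilin (E : Type*) [NormedAddCommGroup E] [NormedSpace ℝ E] :
    (E [⋀^Fin 2]→L[ℝ] ℝ) →L[ℝ] E →L[ℝ] E →L[ℝ] ℝ :=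
  (((ContinuousAlternatingMap.ofSubsingletonLIE (𝕜 := ℝ) (E := E) (F := ℝ) (0 : Fin 1)).symm :
      (E [⋀^Fin 1]→L[ℝ] ℝ) →L[ℝ] E →L[ℝ] ℝ).postcomp E).comp
    (ContinuousAlternatingMap.curryLeftLI (𝕜 := ℝ) (E := E) (F := ℝ) (n := 1)).toContinuousLinearMap

theorem formToBilin_apply (α : E [⋀^Fin 2]→L[ℝ] ℝ) (a b : E) :
    formToBilin E α a b = α ![a, b] := by
  change α (Matrix.vecCons a fun _ => b) = α ![a, b]
  congr 1
  ext i
  fin_cases i <;> rfl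

theorem bilinClosedAt_of_extDeriv_eq_zero {α : E → E [⋀^Fin 2]→L[ℝ] ℝ} {x : E}
    (hα : DifferentiableAt ℝ α x) (h : extDeriv α x = 0) :
    BilinClosedAt (fun y => formToBilin E (α y)) x := by
  intro a b c
  have h1 : ∀ u v w, fderiv ℝ (fun y => formToBilin E (α y)) x u v w =
      fderiv ℝ (fun y => α y ![v, w]) x u := by
    intro u v w
    have h2 := (formToBilin E).hasFDerivAt.comp x hα.hasFDerivAt
    have h3 := (h2.clm_apply (hasFDerivAt_const v x)).clm_apply (hasFDerivAt_const w x)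
    have h4 : (fun y => α y ![v, w]) = fun y => (formToBilin E ∘ α) y v w :=
      funext fun y => (formToBilin_apply _ _ _).symm
    have h5 : fderiv ℝ (fun y => formToBilin E (α y)) x = _ := h2.fderiv
    rw [h4, h3.fderiv, h5]
    simp
  have h6 := extDeriv_apply hα ![a, b, c]
  rw [h, show (0 : E [⋀^Fin 3]→L[ℝ] ℝ) ![a, b, c] = 0 from rfl, Fin.sum_univ_three] at h6
  have e0 : (0 : Fin 3).removeNth ![a, b, c] = ![b, c] := by ext i; fin_cases i <;> rfl
  have e1 : (1 : Fin 3).removeNth ![a, b, c] = ![a, c] := by ext i; fin_cases i <;> rfl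
  have e2 : (2 : Fin 3).removeNth ![a, b, c] = ![a, b] := by ext i; fin_cases i <;> rfl
  rw [e0, e1, e2] at h6
  rw [h1, h1, h1]
  simp at h6
  linarith

end

variable {E : Type*} [NormedAddCommGroup E] [NormedSpace ℝ E] [FiniteDimensional ℝ E]

/-- Closed two-forms on a vector space are brought into the standard form by a map with prescribed
differential at the base point. For `s ≥ 2` this requires functions `x_i` such that the forms
vanish on the fibres of `(x_i)`. -/
theorem exists_map_to_std_of_fibration {n s : ℕ} (hs : 1 ≤ s)
    (hE : Module.finrank ℝ E = n * (s + 1)) {y₀ : E} {α : Fin s → E → E [⋀^Fin 2]→L[ℝ] ℝ}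
    (hα : ∀ j, ∀ᶠ y in 𝓝 y₀, ContDiffAt ℝ ∞ (α j) y)
    (hcl : ∀ j, ∀ᶠ y in 𝓝 y₀, extDeriv (α j) y = 0) {φ : Fin n → E →L[ℝ] ℝ}
    {ψ : Fin s → Fin n → E →L[ℝ] ℝ}
    (hφψ : LinearIndependent ℝ (Sum.elim (fun i => (φ i : Module.Dual ℝ E))
      fun a : Fin s × Fin n => (ψ a.1 a.2 : Module.Dual ℝ E)))
    (hfr : ∀ j u v, α j y₀ ![u, v] = ∑ i, (φ i u * ψ j i v - φ i v * ψ j i u))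
    {x : Fin n → E → ℝ} (hx : ∀ i, ∀ᶠ y in 𝓝 y₀, ContDiffAt ℝ ∞ (x i) y)
    (hx0 : ∀ i, x i y₀ = 0) (hdx0 : ∀ i, fderiv ℝ (x i) y₀ = φ i)
    (hfib : 2 ≤ s → ∀ᶠ y in 𝓝 y₀, ∀ u v, (∀ i, fderiv ℝ (x i) y u = 0) →
      (∀ i, fderiv ℝ (x i) y v = 0) → ∀ j, α j y ![u, v] = 0) :
    ∃ F : E → PolyCoord n s, F y₀ = 0 ∧ (∀ᶠ y in 𝓝 y₀, ContDiffAt ℝ ∞ F y) ∧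
      (fderiv ℝ F y₀).IsInvertible ∧
      (∀ u, fderiv ℝ F y₀ u = (fun i => φ i u, fun j i => ψ j i u)) ∧
      ∀ᶠ y in 𝓝 y₀, ∀ j u v, stdBilin n s j (fderiv ℝ F y u) (fderiv ℝ F y v) = α j y ![u, v] := by
  let G : E → PolyCoord n s := fun y => (fun i => x i y, fun j i => ψ j i (y - y₀))
  have hG : ∀ᶠ y in 𝓝 y₀, ContDiffAt ℝ ∞ G y := by
    filter_upwards [eventually_all.2 hx] with y hy
    refine (contDiffAt_pi.2 fun i => hy i).prodMk (ContDiff.contDiffAt ?_)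
    exact contDiff_pi.2 fun j => contDiff_pi.2 fun i => (ψ j i).contDiff.comp
      (contDiff_id.sub contDiff_const)
  have hdG : ∀ᶠ y in 𝓝 y₀, ∀ u, fderiv ℝ G y u =
      (fun i => fderiv ℝ (x i) y u, fun j i => ψ j i u) := by
    filter_upwards [eventually_all.2 hx] with y hy u
    have h1 : HasFDerivAt G ((ContinuousLinearMap.pi fun i => fderiv ℝ (x i) y).prod
        (ContinuousLinearMap.pi fun j => ContinuousLinearMap.pi fun i => ψ j i)) y := by
      refine HasFDerivAt.prodMk (hasFDerivAt_pi.2 fun i => ?_)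
        (hasFDerivAt_pi.2 fun j => hasFDerivAt_pi.2 fun i => ?_)
      · exact ((hy i).differentiableAt (by simp)).hasFDerivAt
      · exact (ψ j i).hasFDerivAt.comp y ((hasFDerivAt_id y).sub_const y₀)
    rw [h1.fderiv]
    rfl
  have hG0 : G y₀ = 0 := by
    ext <;> simp [G, hx0]
  have hdG0 : ∀ u, fderiv ℝ G y₀ u = (fun i => φ i u, fun j i => ψ j i u) := fun u => by
    simp only [hdG.self_of_nhds u, hdx0]
  have hdim : Module.finrank ℝ E = Module.finrank ℝ (PolyCoord n s) := by
    rw [hE, Module.finrank_prod, Module.finrank_pi, Module.finrank_pi_fintype]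
    simp only [Module.finrank_pi, Fintype.card_fin, Finset.sum_const, Finset.card_univ,
      smul_eq_mul]
    ring
  have hinv : (fderiv ℝ G y₀).IsInvertible := by
    have hsurj : Function.Surjective (fderiv ℝ G y₀) := by
      intro c
      obtain ⟨u, hu⟩ := exists_forall_apply_eq_of_linearIndependent hφψ
        (Sum.elim c.1 fun a => c.2 a.1 a.2)
      refine ⟨u, ?_⟩
      rw [hdG0]
      exact Prod.ext (funext fun i => hu (Sum.inl i))
        (funext fun j => funext fun i => hu (Sum.inr (j, i)))
    exact isInvertible_of_injective ((injective_iff_map_eq_zero (fderiv ℝ G y₀)).1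
      ((LinearMap.injective_iff_surjective_of_finrank_eq_finrank
        (f := (fderiv ℝ G y₀).toLinearMap) hdim).2 hsurj)) hdim
  obtain ⟨R, hRG, hy₀, hR, hRs⟩ := exists_smooth_openPartialHomeomorph hG hinv
    (hdG.and ((eventually_all.2 hα).and (eventually_all.2 hcl)))
  have h0t : (0 : PolyCoord n s) ∈ R.target := by
    have := R.map_source hy₀
    rwa [hRG, hG0] at this
  have hR0 : R.symm 0 = y₀ := by
    have := R.left_inv hy₀
    rwa [hRG, hG0] at this
  have htgt : ∀ᶠ z in 𝓝 (0 : PolyCoord n s), z ∈ R.target := R.open_target.mem_nhds h0t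
  have hcomp : ∀ z ∈ R.target, ∀ u, fderiv ℝ G (R.symm z) (fderiv ℝ R.symm z u) = u := by
    intro z hz u
    have h1 := ((hR _ (R.map_target hz)).1.differentiableAt (by simp)).hasFDerivAt.comp z
      ((hRs z hz).differentiableAt (by simp)).hasFDerivAt
    have h2 : G ∘ R.symm =ᶠ[𝓝 z] id := by
      rw [← hRG]
      filter_upwards [R.open_target.mem_nhds hz] with z' hz' using R.right_inv hz'
    exact congrArg (fun A => A u) (h1.unique ((hasFDerivAt_id z).congr_of_eventuallyEq h2))
  have hcomp' : ∀ y ∈ R.source, ∀ u, fderiv ℝ R.symm (G y) (fderiv ℝ G y u) = u := by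
    intro y hy u
    have hy' : G y ∈ R.target := hRG ▸ R.map_source hy
    have h1 := ((hRs _ hy').differentiableAt (by simp)).hasFDerivAt.comp y
      ((hR y hy).1.differentiableAt (by simp)).hasFDerivAt
    have h2 : R.symm ∘ G =ᶠ[𝓝 y] id := by
      rw [← hRG]
      filter_upwards [R.open_source.mem_nhds hy] with z' hz' using R.left_inv hz'
    exact congrArg (fun A => A u) (h1.unique ((hasFDerivAt_id y).congr_of_eventuallyEq h2))
  -- the forms in the coordinates given by `G`
  let A : Fin s → PolyCoord n s → PolyCoord n s [⋀^Fin 2]→L[ℝ] ℝ := fun j z =>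
    (α j (R.symm z)).compContinuousLinearMap (fderiv ℝ R.symm z)
  have hA : ∀ j z u v, formToBilin (PolyCoord n s) (A j z) u v =
      α j (R.symm z) ![fderiv ℝ R.symm z u, fderiv ℝ R.symm z v] := by
    intro j z u v
    rw [formToBilin_apply, ContinuousAlternatingMap.compContinuousLinearMap_apply]
    congr 1
    ext i
    fin_cases i <;> rfl
  have hfs : ∀ z ∈ R.target, ContDiffAt ℝ ∞ (fderiv ℝ R.symm) z := fun z hz =>
    (hRs z hz).fderiv_right (by simp)
  have hAcd : ∀ j, ∀ᶠ z in 𝓝 0,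
      ContDiffAt ℝ ∞ (fun z => formToBilin (PolyCoord n s) (A j z)) z := by
    intro j
    filter_upwards [htgt] with z hz
    have h1 : ContDiffAt ℝ ∞ (fun z => formToBilin E (α j (R.symm z))) z :=
      (formToBilin E).contDiff.contDiffAt.comp z
        (((hR _ (R.map_target hz)).2.2.1 j).comp z (hRs z hz))
    have h2 := (ContinuousLinearMap.flipₗᵢ ℝ (PolyCoord n s) E ℝ).contDiff.contDiffAt.comp z
      (h1.clm_comp (hfs z hz))
    have h3 := (ContinuousLinearMap.flipₗᵢ ℝ (PolyCoord n s) (PolyCoord n s) ℝ).contDiff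
      |>.contDiffAt.comp z (h2.clm_comp (hfs z hz))
    refine h3.congr_of_eventuallyEq (Eventually.of_forall fun z => ?_)
    refine ContinuousLinearMap.ext fun u => ContinuousLinearMap.ext fun v => ?_
    exact (hA j z u v).trans (formToBilin_apply _ _ _).symm
  have hAcl : ∀ j, ∀ᶠ z in 𝓝 0, BilinClosedAt (fun z => formToBilin (PolyCoord n s) (A j z)) z := by
    intro j
    filter_upwards [htgt] with z hz
    have hz' := (hR _ (R.map_target hz)).2
    have hd := (hz'.2.1 j).differentiableAt (by simp)
    refine bilinClosedAt_of_extDeriv_eq_zero ?_ ?_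
    · exact ((hd.hasFDerivAt.comp z
        ((hRs z hz).differentiableAt (by simp)).hasFDerivAt)
        |>.continuousAlternatingMapCompContinuousLinearMap
        ((hfs z hz).differentiableAt (by simp)).hasFDerivAt).differentiableAt
    · rw [extDeriv_pullback hd (hRs z hz) minSmoothness_two_le_infty, hz'.2.2 j]
      ext v
      rfl
  have hw : ∀ j, ∃ w : PolyCoord n s → PolyCoord n s →L[ℝ] PolyCoord n s →L[ℝ] ℝ,
      ContDiff ℝ ∞ w ∧ ∀ᶠ z in 𝓝 0, w z = formToBilin (PolyCoord n s) (A j z) := fun j =>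
    exists_contDiff_eventuallyEq_nhds (hAcd j)
  choose w hw hwA using hw
  obtain ⟨Ψ, hΨ0, hdΨ0, hΨ, hΨw⟩ := exists_map_to_stdBilin hs hw
    (fun j => by
      filter_upwards [hwA j] with z hz a
      rw [hz, hA]
      exact (α j (R.symm z)).map_eq_zero_of_eq _ (i := 0) (j := 1) rfl (by decide))
    (fun j => by
      filter_upwards [(hwA j).eventually_nhds, hAcl j] with z hz hz' a b c
      have : fderiv ℝ (w j) z = _ := EventuallyEq.fderiv_eq hz
      rw [this]
      exact hz' a b c)
    (fun j => by
      refine ContinuousLinearMap.ext fun u => ContinuousLinearMap.ext fun v => ?_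
      have h1 := hcomp 0 h0t
      rw [hR0] at h1
      have h2 : ∀ u,
          (fun i => φ i (fderiv ℝ R.symm 0 u), fun j i => ψ j i (fderiv ℝ R.symm 0 u)) = u :=
        fun u => (hdG0 _).symm.trans (h1 u)
      have h3 : ∀ u i, φ i (fderiv ℝ R.symm 0 u) = u.1 i := fun u i =>
        congrFun (congrArg Prod.fst (h2 u)) i
      have h4 : ∀ u j i, ψ j i (fderiv ℝ R.symm 0 u) = u.2 j i := fun u j i =>
        congrFun (congrFun (congrArg Prod.snd (h2 u)) j) i
      rw [(hwA j).self_of_nhds, hA, hR0, hfr, stdBilin_apply]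
      simp only [h3, h4])
    (fun hs2 j => by
      have hc : Tendsto R.symm (𝓝 0) (𝓝 y₀) := by
        have := (hRs 0 h0t).continuousAt
        rwa [ContinuousAt, hR0] at this
      filter_upwards [hwA j, htgt, hc.eventually (hfib hs2)] with z hz hzt hz' b c
      have h1 : ∀ (b : Fin s → Fin n → ℝ) i,
          fderiv ℝ (x i) (R.symm z) (fderiv ℝ R.symm z (0, b)) = 0 := by
        intro b i
        have h2 := hcomp z hzt (0, b)
        rw [(hR _ (R.map_target hzt)).2.1] at h2
        exact congrFun (congrArg Prod.fst h2) i
      rw [hz, hA]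
      exact hz' _ _ (h1 b) (h1 c) j)
  have hGc : Tendsto G (𝓝 y₀) (𝓝 0) := by
    have := hG.self_of_nhds.continuousAt
    rwa [ContinuousAt, hG0] at this
  have hdF : ∀ᶠ y in 𝓝 y₀, fderiv ℝ (Ψ ∘ G) y = (fderiv ℝ Ψ (G y)).comp (fderiv ℝ G y) := by
    filter_upwards [hG, hGc.eventually hΨ] with y hy hy'
    exact fderiv_comp y (hy'.differentiableAt (by simp)) (hy.differentiableAt (by simp))
  have hdF0 : fderiv ℝ (Ψ ∘ G) y₀ = fderiv ℝ G y₀ := by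
    rw [hdF.self_of_nhds, hG0, hdΨ0, ContinuousLinearMap.id_comp]
  refine ⟨Ψ ∘ G, by rw [Function.comp_apply, hG0, hΨ0], ?_, by rwa [hdF0], by rwa [hdF0], ?_⟩
  · filter_upwards [hG, hGc.eventually hΨ] with y hy hy'
    exact hy'.comp y hy
  · filter_upwards [hdF, hGc.eventually hΨw, hGc.eventually (eventually_all.2 hwA),
      R.open_source.mem_nhds hy₀] with y h1 h2 h3 hy j u v
    have h4 : R.symm (G y) = y := hRG ▸ R.left_inv hy
    rw [h1, ContinuousLinearMap.comp_apply, ContinuousLinearMap.comp_apply, h2, h3, hA, h4,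
      hcomp' y hy, hcomp' y hy]

end Coordinates

/-! ### Polysymplectic charts -/

section Charts

open Filter Topology

set_option maxSynthPendingDepth 5

/-- Independent covectors annihilated by the powers `Ω_jⁿ` cut out a subspace on which all `Ω_j`
vanish: they span the same space as the first half of a frame. -/
theorem IsPolysymplecticSpace.apply_eq_zero {V : Type*} [AddCommGroup V] [Module ℝ V]
    [FiniteDimensional ℝ V] {n s : ℕ} {Ω : Fin s → V [⋀^Fin 2]→ₗ[ℝ] ℝ}
    (hΩ : IsPolysymplecticSpace n Ω) (hs : 2 ≤ s) {η : Fin n → Module.Dual ℝ V}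
    (hη : LinearIndependent ℝ η)
    (hηΩ : ∀ i j, ExteriorAlgebra.ι ℝ (η i) * twoFormToExterior (Ω j) ^ n = 0) {u v : V}
    (hu : ∀ i, η i u = 0) (hv : ∀ i, η i v = 0) (j : Fin s) : Ω j ![u, v] = 0 := by
  obtain ⟨φ, ψ, hf⟩ := hΩ.exists_frame (by omega)
  have hφ : LinearIndependent ℝ φ :=
    (hΩ.linearIndependent_frame (by omega) hf).comp Sum.inl Sum.inl_injective
  have hle : Submodule.span ℝ (Set.range η) ≤ Submodule.span ℝ (Set.range φ) := by
    rw [Submodule.span_le]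
    rintro _ ⟨i, rfl⟩
    exact (hΩ.mem_span_iff hs hf _).2 (hηΩ i)
  have heq := Submodule.eq_of_le_of_finrank_eq hle (by
    rw [finrank_span_eq_card hη, finrank_span_eq_card hφ])
  have key : ∀ u, (∀ i, η i u = 0) → ∀ i, φ i u = 0 := fun u hu => by
    rwa [← forall_mem_span_apply_eq_zero_iff, ← heq, forall_mem_span_apply_eq_zero_iff]
  rw [← AlternatingMap.flat_apply, hf]
  simp [key u hu, key v hv]

universe u

/-- Poincaré lemma for alternating one-forms near an arbitrary point. -/
theorem exists_primitive_of_extDeriv_eq_zero {E : Type u} [NormedAddCommGroup E] [NormedSpace ℝ E]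
    [FiniteDimensional ℝ E] {α : E → E [⋀^Fin 1]→L[ℝ] ℝ} {y₀ : E}
    (hα : ∀ᶠ y in 𝓝 y₀, ContDiffAt ℝ ∞ α y) (hcl : ∀ᶠ y in 𝓝 y₀, extDeriv α y = 0) :
    ∃ f : E → ℝ, ContDiff ℝ ∞ f ∧ f y₀ = 0 ∧
      ∀ᶠ y in 𝓝 y₀, ∀ u, fderiv ℝ f y u = α y fun _ => u := by
  let L : (E [⋀^Fin 1]→L[ℝ] ℝ) →L[ℝ] E →L[ℝ] ℝ :=
    (ContinuousAlternatingMap.ofSubsingletonLIE (𝕜 := ℝ) (E := E) (F := ℝ) (0 : Fin 1)).symm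
  have hL : ∀ a u, L a u = a fun _ => u := fun a u => rfl
  have ht : Tendsto (fun z : E => y₀ + z) (𝓝 0) (𝓝 y₀) := by
    have : ContinuousAt (fun z : E => y₀ + z) 0 := by fun_prop
    rwa [ContinuousAt, add_zero] at this
  have hsm : ∀ᶠ z in 𝓝 0, ContDiffAt ℝ ∞ (fun z => L (α (y₀ + z))) z := by
    filter_upwards [ht.eventually hα] with z hz
    exact L.contDiff.contDiffAt.comp z (hz.comp z (contDiff_const.add contDiff_id).contDiffAt)
  obtain ⟨β, hβ, hβα⟩ := exists_contDiff_eventuallyEq_nhds hsm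
  obtain ⟨f, hf, hdf⟩ := exists_primitive_along_range hβ (P := ContinuousLinearMap.id ℝ E)
    (fun v => rfl) (by
      filter_upwards [hβα.eventually_nhds, ht.eventually hα, ht.eventually hcl] with z h1 h2 h3 a b
      have hd := h2.differentiableAt (by simp)
      have h4 : ∀ u v, fderiv ℝ β z u v = fderiv ℝ (fun y => α y fun _ => v) (y₀ + z) u := by
        intro u v
        have e1 := L.hasFDerivAt.comp (y₀ + z) hd.hasFDerivAt
        have e2 : HasFDerivAt (fun y => α y fun _ => v) _ (y₀ + z) :=
          e1.clm_apply (hasFDerivAt_const v (y₀ + z))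
        have e3 : HasFDerivAt (fun z => L (α (y₀ + z))) _ z :=
          e1.comp z ((hasFDerivAt_id z).const_add y₀)
        rw [EventuallyEq.fderiv_eq h1, e2.fderiv, e3.fderiv]
        simp
      have h5 := extDeriv_apply hd ![a, b]
      have e0 : (0 : Fin 2).removeNth ![a, b] = fun _ => b := by ext i; fin_cases i; rfl
      have e1 : (1 : Fin 2).removeNth ![a, b] = fun _ => a := by ext i; fin_cases i; rfl
      rw [h3, show (0 : E [⋀^Fin 2]→L[ℝ] ℝ) ![a, b] = 0 from rfl, Fin.sum_univ_two, e0, e1] at h5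
      simp at h5
      rw [ContinuousLinearMap.id_apply, ContinuousLinearMap.id_apply, h4, h4]
      linarith)
  have hs : Tendsto (fun y : E => y - y₀) (𝓝 y₀) (𝓝 0) := by
    have : ContinuousAt (fun y : E => y - y₀) y₀ := by fun_prop
    rwa [ContinuousAt, sub_self] at this
  refine ⟨fun y => f (y - y₀) - f 0, (hf.comp (contDiff_id.sub contDiff_const)).sub contDiff_const,
    by simp, ?_⟩
  filter_upwards [hs.eventually hdf, hs.eventually hβα] with y h1 h2 u
  have h3 : HasFDerivAt (fun y => f (y - y₀) - f 0) _ y :=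
    (((hf.differentiable (by simp)).differentiableAt.hasFDerivAt).comp y
      ((hasFDerivAt_id y).sub_const y₀)).sub_const (f 0)
  rw [h3.fderiv, ← hL, ContinuousLinearMap.comp_id]
  refine (h1 u).trans ?_
  rw [h2, add_sub_cancel]
  rfl

variable {E : Type*} [NormedAddCommGroup E] [NormedSpace ℝ E] {M : Type*} [TopologicalSpace M]
  [ChartedSpace E M]

theorem DiffForm.inChart_apply {k : ℕ} (Ω : DiffForm E M k) (e : OpenPartialHomeomorph M E) (y : E)
    (v : Fin k → E) :
    Ω.inChart e y v = Ω (e.symm y) fun i => mfderiv 𝓘(ℝ, E) 𝓘(ℝ, E) e.symm y (v i) :=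
  rfl

/-- A form is the pullback of its expression in a chart. -/
theorem DiffForm.inChart_apply_mfderiv [IsManifold 𝓘(ℝ, E) ∞ M] {k : ℕ} (Ω : DiffForm E M k)
    {e : OpenPartialHomeomorph M E} (he : e ∈ atlas E M) {q : M} (hq : q ∈ e.source)
    (v : Fin k → TangentSpace 𝓘(ℝ, E) q) :
    Ω.inChart e (e q) (fun i => mfderiv 𝓘(ℝ, E) 𝓘(ℝ, E) e q (v i)) = Ω q v := by
  have : IsManifold 𝓘(ℝ, E) 1 M := IsManifold.of_le (n := ∞) (by simp)
  have h1 := (mdifferentiable_of_mem_atlas (I := 𝓘(ℝ, E)) he).symm_comp_deriv hq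
  have h2 : ∀ u : TangentSpace 𝓘(ℝ, E) q, mfderiv 𝓘(ℝ, E) 𝓘(ℝ, E) e.symm (e q)
      (mfderiv 𝓘(ℝ, E) 𝓘(ℝ, E) e q u) = u := fun u => congrArg (fun A => A u) h1
  have h3 : ∀ q', q' = q → ∀ w : Fin k → E, Ω q' w = Ω q w := by
    rintro _ rfl w
    rfl
  refine (DiffForm.inChart_apply Ω e (e q) _).trans ((h3 _ (e.left_inv hq) _).trans ?_)
  congr 1
  funext i
  exact h2 (v i)

end Charts

section NormalFormChart

open Filter Topology

set_option maxSynthPendingDepth 5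

variable {E : Type*} [NormedAddCommGroup E] [NormedSpace ℝ E] [FiniteDimensional ℝ E]
  {M : Type*} [TopologicalSpace M] [ChartedSpace E M] [IsManifold 𝓘(ℝ, E) ∞ M] {n s : ℕ}

/-- Covectors in the distribution at `p` are the differentials of functions `x_i`, expressed in a
chart, whose differentials at nearby points lie in the distribution, so that all forms vanish on
the fibres of `(x_i)`. The `x_i` are combinations of primitives of the closed generators. -/
theorem IsPolysymplecticManifold.exists_fibration {Ω : Fin s → DiffForm E M 2}
    (hΩ : IsPolysymplecticManifold n Ω) (hs : 2 ≤ s) {e : OpenPartialHomeomorph M E}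
    (he : e ∈ atlas E M) {p : M} (hp : p ∈ e.source) {φ : Fin n → E →L[ℝ] ℝ}
    (hφ : LinearIndependent ℝ φ)
    (hφp : ∀ i, ∃ a ∈ polyDistribution n Ω p, ∀ v : TangentSpace 𝓘(ℝ, E) p,
      a v = φ i (mfderiv 𝓘(ℝ, E) 𝓘(ℝ, E) e p v)) :
    ∃ x : Fin n → E → ℝ, (∀ i, ContDiff ℝ ∞ (x i)) ∧ (∀ i, x i (e p) = 0) ∧
      (∀ i, fderiv ℝ (x i) (e p) = φ i) ∧
      ∀ᶠ y in 𝓝 (e p), ∀ u v, (∀ i, fderiv ℝ (x i) y u = 0) → (∀ i, fderiv ℝ (x i) y v = 0) →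
        ∀ j, (Ω j).inChart e y ![u, v] = 0 := by
  have : IsManifold 𝓘(ℝ, E) 1 M := IsManifold.of_le (n := ∞) (by simp)
  obtain ⟨U, hU, hpU, m, θ, hθs, hθc, hθ⟩ := hΩ.generated p
  have hsymm : Tendsto e.symm (𝓝 (e p)) (𝓝 p) := by
    have := e.continuousAt_symm (e.map_source hp)
    rwa [ContinuousAt, e.left_inv hp] at this
  have hyU : ∀ᶠ y in 𝓝 (e p), y ∈ e.target ∩ e.symm ⁻¹' U :=
    Filter.Eventually.and (e.open_target.mem_nhds (e.map_source hp))
      (hsymm.eventually (hU.mem_nhds hpU))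
  have hopen : IsOpen (e.target ∩ e.symm ⁻¹' U) := e.isOpen_inter_preimage_symm hU
  have hex : ∀ k, ∃ f : E → ℝ, ContDiff ℝ ∞ f ∧ f (e p) = 0 ∧
      ∀ᶠ y in 𝓝 (e p), ∀ u, fderiv ℝ f y u = (θ k).inChart e y fun _ => u := by
    intro k
    refine exists_primitive_of_extDeriv_eq_zero ?_ ?_
    · filter_upwards [hyU] with y hy
      exact (hθs k e he).contDiffAt (hopen.mem_nhds hy)
    · filter_upwards [hyU] with y hy
      exact hθc k e he y hy
  choose f hf hf0 hdf using hex
  choose a ha haφ using hφp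
  have hcoef : ∀ i, ∃ c : Fin m → ℝ, ∑ k, c k • (θ k).covectorAt p = a i := fun i => by
    have h := ha i
    rwa [← hθ p hpU, Submodule.mem_span_range_iff_exists_fun] at h
  choose c hc using hcoef
  have hx : ∀ i, ContDiff ℝ ∞ fun y => ∑ k, c i k * f k y := fun i =>
    ContDiff.sum fun k _ => contDiff_const.mul (hf k)
  have hdx : ∀ᶠ y in 𝓝 (e p), ∀ i u, fderiv ℝ (fun y => ∑ k, c i k * f k y) y u =
      ∑ k, c i k * (θ k).inChart e y fun _ => u := by
    filter_upwards [eventually_all.2 hdf] with y hy i u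
    have h1 : HasFDerivAt (fun y => ∑ k, c i k * f k y) (∑ k, c i k • fderiv ℝ (f k) y) y :=
      HasFDerivAt.fun_sum fun k _ =>
        (((hf k).differentiable (by simp)).differentiableAt.hasFDerivAt).const_mul (c i k)
    rw [h1.fderiv, _root_.sum_apply]
    exact Finset.sum_congr rfl fun k _ => by rw [_root_.smul_apply, hy, smul_eq_mul]
  have hdx0 : ∀ i, fderiv ℝ (fun y => ∑ k, c i k * f k y) (e p) = φ i := by
    intro i
    refine ContinuousLinearMap.ext fun u => ?_
    obtain ⟨v, rfl⟩ := ((mdifferentiable_of_mem_atlas (I := 𝓘(ℝ, E)) he).mfderiv_bijective hp).2 u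
    refine (hdx.self_of_nhds i _).trans (Eq.trans ?_ (haφ i v))
    rw [← hc i, LinearMap.sum_apply]
    refine Finset.sum_congr rfl fun k _ => ?_
    rw [LinearMap.smul_apply, smul_eq_mul, DiffForm.covectorAt_apply]
    congr 1
    exact (θ k).inChart_apply_mfderiv he hp fun _ => v
  refine ⟨fun i y => ∑ k, c i k * f k y, hx, fun i => by simp [hf0], hdx0, ?_⟩
  have hind : ∀ᶠ y in 𝓝 (e p), LinearIndependent ℝ fun i =>
      fderiv ℝ (fun y => ∑ k, c i k * f k y) y := by
    have hcont : Continuous fun y i => fderiv ℝ (fun y => ∑ k, c i k * f k y) y :=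
      continuous_pi fun i => (hx i).continuous_fderiv (by simp)
    refine hcont.continuousAt.eventually (isOpen_setOfPred_linearIndependent.mem_nhds ?_)
    change LinearIndependent ℝ fun i => fderiv ℝ (fun y => ∑ k, c i k * f k y) (e p)
    simpa only [hdx0] using hφ
  filter_upwards [hyU, hdx, hind] with y hy hdy hiy u v hu hv j
  let η : Fin n → Module.Dual ℝ (TangentSpace 𝓘(ℝ, E) (e.symm y)) := fun i =>
    ∑ k, c i k • (θ k).covectorAt (e.symm y)
  have hηd : ∀ i (u : E), η i (mfderiv 𝓘(ℝ, E) 𝓘(ℝ, E) e.symm y u) =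
      fderiv ℝ (fun y => ∑ k, c i k * f k y) y u := by
    intro i u
    rw [hdy, LinearMap.sum_apply]
    rfl
  have hη : LinearIndependent ℝ η := by
    rw [Fintype.linearIndependent_iff] at hiy ⊢
    intro g hg
    refine hiy g (ContinuousLinearMap.ext fun u => ?_)
    rw [_root_.sum_apply]
    refine Eq.trans ?_ (congrArg (fun A => A (mfderiv 𝓘(ℝ, E) 𝓘(ℝ, E) e.symm y u)) hg)
    rw [LinearMap.sum_apply]
    refine Finset.sum_congr rfl fun i _ => ?_
    rw [_root_.smul_apply, LinearMap.smul_apply, hηd]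
  have hηΩ : ∀ i, η i ∈ polyDistribution n Ω (e.symm y) := fun i => by
    rw [← hθ _ hy.2]
    exact Submodule.sum_mem _ fun k _ => Submodule.smul_mem _ _ (Submodule.subset_span ⟨k, rfl⟩)
  have h := (hΩ.pointwise (e.symm y)).apply_eq_zero hs hη (fun i j => hηΩ i j)
    (fun i => (hηd i u).trans (hu i)) (fun i => (hηd i v).trans (hv i)) j
  rw [DiffForm.inChart_apply]
  refine Eq.trans ?_ h
  change Ω j (e.symm y) _ = Ω j (e.symm y) _
  congr 1
  funext i
  fin_cases i <;> rfl

theorem stdPolyForm_apply (j : Fin s) (z u v : PolyCoord n s) :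
    stdPolyForm n s j z ![u, v] = stdBilin n s j u v := by
  have h1 : ∀ i, mfderiv 𝓘(ℝ, PolyCoord n s) 𝓘(ℝ, ℝ) (fun w : PolyCoord n s => w.1 i) z =
      polyX n s i := fun i => by
    rw [mfderiv_eq_fderiv]
    exact (polyX n s i).fderiv
  have h2 : ∀ i, mfderiv 𝓘(ℝ, PolyCoord n s) 𝓘(ℝ, ℝ) (fun w : PolyCoord n s => w.2 j i) z =
      polyY n s j i := fun i => by
    rw [mfderiv_eq_fderiv]
    exact (polyY n s j i).fderiv
  rw [stdBilin_apply, stdPolyForm]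
  refine (ContinuousAlternatingMap.sum_apply _ _).trans (Finset.sum_congr rfl fun i _ => ?_)
  refine (covectorWedge_apply _ _ u v).trans ?_
  rw [h1, h2]
  rfl

/-- The normal form, with prescribed differentials of the coordinates at `p`. -/
theorem IsPolysymplecticManifold.exists_chart {Ω : Fin s → DiffForm E M 2}
    (hΩ : IsPolysymplecticManifold n Ω) (hs : 1 ≤ s) (p : M)
    (φ : Fin n → TangentSpace 𝓘(ℝ, E) p →L[ℝ] ℝ)
    (ψ : Fin s → Fin n → TangentSpace 𝓘(ℝ, E) p →L[ℝ] ℝ)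
    (hφψ : ∀ j, Ω j p = ∑ i, covectorWedge (φ i) (ψ j i)) :
    ∃ Φ : OpenPartialHomeomorph M (PolyCoord n s), IsPolysymplecticChartAt Ω p Φ ∧
      (∀ i, mfderiv 𝓘(ℝ, E) 𝓘(ℝ, ℝ) (fun q => (Φ q).1 i) p = φ i) ∧
      (∀ j i, mfderiv 𝓘(ℝ, E) 𝓘(ℝ, ℝ) (fun q => (Φ q).2 j i) p = ψ j i) := by
  have : IsManifold 𝓘(ℝ, E) 1 M := IsManifold.of_le (n := ∞) (by simp)
  set e := chartAt E p
  have he : e ∈ atlas E M := chart_mem_atlas E p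
  have hp : p ∈ e.source := mem_chart_source E p
  have hem := mdifferentiable_of_mem_atlas (I := 𝓘(ℝ, E)) he
  have hval : ∀ j (u v : TangentSpace 𝓘(ℝ, E) p),
      Ω j p ![u, v] = ∑ i, (φ i u * ψ j i v - φ i v * ψ j i u) := by
    intro j u v
    rw [hφψ j]
    exact (ContinuousAlternatingMap.sum_apply _ _).trans
      (Finset.sum_congr rfl fun i _ => covectorWedge_apply _ _ _ _)
  have hframe : IsPolyFrame (fun j => (Ω j p).toAlternatingMap)
      (fun i => (φ i : Module.Dual ℝ (TangentSpace 𝓘(ℝ, E) p)))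
      (fun j i => (ψ j i : Module.Dual ℝ (TangentSpace 𝓘(ℝ, E) p))) := fun j u v => hval j u v
  have hindep := (hΩ.pointwise p).linearIndependent_frame hs hframe
  -- the frame in the chart
  let D := hem.mfderiv hp
  let φ' : Fin n → E →L[ℝ] ℝ := fun i => (φ i).comp
    (D.symm : TangentSpace 𝓘(ℝ, E) (e p) →L[ℝ] TangentSpace 𝓘(ℝ, E) p)
  let ψ' : Fin s → Fin n → E →L[ℝ] ℝ := fun j i =>
    (ψ j i).comp
    (D.symm : TangentSpace 𝓘(ℝ, E) (e p) →L[ℝ] TangentSpace 𝓘(ℝ, E) p)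
  have hD : ∀ u : TangentSpace 𝓘(ℝ, E) p, D.symm (mfderiv 𝓘(ℝ, E) 𝓘(ℝ, E) e p u) = u :=
    D.symm_apply_apply
  have hD' : ∀ u : E, mfderiv 𝓘(ℝ, E) 𝓘(ℝ, E) e p (D.symm u) = u := D.apply_symm_apply
  have hindep' : LinearIndependent ℝ (Sum.elim (fun i => (φ' i : Module.Dual ℝ E))
      fun a : Fin s × Fin n => (ψ' a.1 a.2 : Module.Dual ℝ E)) := by
    have h := hindep.map' D.symm.toLinearEquiv.dualMap.toLinearMap (LinearEquiv.ker _)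
    have h' : D.symm.toLinearEquiv.dualMap ∘ Sum.elim
        (fun i => (φ i : Module.Dual ℝ (TangentSpace 𝓘(ℝ, E) p)))
        (fun a : Fin s × Fin n => (ψ a.1 a.2 : Module.Dual ℝ (TangentSpace 𝓘(ℝ, E) p))) =
        Sum.elim (fun i => (φ' i : Module.Dual ℝ E))
          fun a : Fin s × Fin n => (ψ' a.1 a.2 : Module.Dual ℝ E) := by
      funext a
      cases a <;> rfl
    rw [← h']
    exact h
  have hfr : ∀ j u v, (Ω j).inChart e (e p) ![u, v] =
      ∑ i, (φ' i u * ψ' j i v - φ' i v * ψ' j i u) := by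
    intro j u v
    refine Eq.trans ?_ (hval j (D.symm u) (D.symm v))
    rw [← (Ω j).inChart_apply_mfderiv he hp]
    congr 1
    funext i
    fin_cases i
    exacts [(hD' u).symm, (hD' v).symm]
  have hfib : ∃ x : Fin n → E → ℝ, (∀ i, ContDiff ℝ ∞ (x i)) ∧ (∀ i, x i (e p) = 0) ∧
      (∀ i, fderiv ℝ (x i) (e p) = φ' i) ∧ (2 ≤ s →
      ∀ᶠ y in 𝓝 (e p), ∀ u v, (∀ i, fderiv ℝ (x i) y u = 0) → (∀ i, fderiv ℝ (x i) y v = 0) →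
        ∀ j, (Ω j).inChart e y ![u, v] = 0) := by
    by_cases hs2 : 2 ≤ s
    · have hφ' : LinearIndependent ℝ φ' :=
        LinearIndependent.of_comp (ContinuousLinearMap.coeLM ℝ)
          (hindep'.comp Sum.inl Sum.inl_injective)
      obtain ⟨x, h1, h2, h3, h4⟩ := hΩ.exists_fibration hs2 he hp hφ' fun i =>
        ⟨φ i, ((hΩ.pointwise p).mem_span_iff hs2 hframe _).1 (Submodule.subset_span ⟨i, rfl⟩),
          fun v => congrArg (φ i) (hD v).symm⟩
      exact ⟨x, h1, h2, h3, fun _ => h4⟩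
    · refine ⟨fun i y => φ' i (y - e p), fun i => (φ' i).contDiff.comp
        (contDiff_id.sub contDiff_const), fun i => by simp, fun i => ?_, fun h => absurd h hs2⟩
      exact ((φ' i).hasFDerivAt.comp (e p) ((hasFDerivAt_id (e p)).sub_const (e p))).fderiv
  obtain ⟨x, hx, hx0, hdx0, hxΩ⟩ := hfib
  have htgt : ∀ᶠ y in 𝓝 (e p), y ∈ e.target := e.open_target.mem_nhds (e.map_source hp)
  obtain ⟨F, hF0, hF, hFinv, hdF0, hFΩ⟩ := exists_map_to_std_of_fibration hs hΩ.finrank_eq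
    (α := fun j => (Ω j).inChart e)
    (fun j => by
      filter_upwards [htgt] with y hy
      refine (hΩ.smooth j e he).contDiffAt ?_
      rw [Set.preimage_univ, Set.inter_univ]
      exact e.open_target.mem_nhds hy)
    (fun j => by
      filter_upwards [htgt] with y hy
      exact hΩ.closed j e he y ⟨hy, trivial⟩)
    hindep' hfr (fun i => Eventually.of_forall fun y => (hx i).contDiffAt) hx0 hdx0 hxΩ
  obtain ⟨R, rfl, hpR, hR, hRs⟩ := exists_smooth_openPartialHomeomorph hF hFinv hFΩ
  have hdΦ : ∀ q ∈ e.source, e q ∈ R.source → HasMFDerivAt 𝓘(ℝ, E) 𝓘(ℝ, PolyCoord n s) (e.trans R) q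
      ((fderiv ℝ R (e q)).comp (mfderiv 𝓘(ℝ, E) 𝓘(ℝ, E) e q)) := by
    intro q hq hqR
    exact HasMFDerivAt.comp (g := R) (f := e) q
      ((hR _ hqR).1.differentiableAt (by simp)).hasFDerivAt.hasMFDerivAt
      (hem.mdifferentiableAt hq).hasMFDerivAt
  have hcoord : ∀ (l : PolyCoord n s →L[ℝ] ℝ) (v : TangentSpace 𝓘(ℝ, E) p),
      mfderiv 𝓘(ℝ, E) 𝓘(ℝ, ℝ) (fun q => l (e.trans R q)) p v =
        l (fderiv ℝ R (e p) (mfderiv 𝓘(ℝ, E) 𝓘(ℝ, E) e p v)) := by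
    intro l v
    have h1 := HasMFDerivAt.comp (g := l) (f := e.trans R) p
      (l.hasFDerivAt (x := e.trans R p)).hasMFDerivAt (hdΦ p hp hpR)
    have h2 : mfderiv 𝓘(ℝ, E) 𝓘(ℝ, ℝ) (fun q => l (e.trans R q)) p = _ := h1.mfderiv
    rw [h2]
    rfl
  refine ⟨e.trans R, ⟨⟨hp, hpR⟩, hF0, ?_, ?_, ?_⟩, fun i => ?_, fun j i => ?_⟩
  · refine ContMDiffOn.comp (t := R.source) (fun y hy => ?_)
      ((contMDiffOn_chart (I := 𝓘(ℝ, E)) (x := p)).mono fun q hq => hq.1) fun q hq => hq.2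
    exact (hR y hy).1.contMDiffAt.contMDiffWithinAt
  · refine ContMDiffOn.comp (t := e.target) (contMDiffOn_chart_symm (I := 𝓘(ℝ, E)) (x := p))
      (fun z hz => ?_) fun z hz => hz.2
    exact (hRs z hz.1).contMDiffAt.contMDiffWithinAt
  · intro j q hq
    refine ContinuousAlternatingMap.ext fun v => ?_
    refine ((Ω j).inChart_apply_mfderiv he hq.1 v).symm.trans ?_
    have h1 : (fun i => mfderiv 𝓘(ℝ, E) 𝓘(ℝ, E) e q (v i)) =
        (![mfderiv 𝓘(ℝ, E) 𝓘(ℝ, E) e q (v 0), mfderiv 𝓘(ℝ, E) 𝓘(ℝ, E) e q (v 1)] : Fin 2 → E) := by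
      funext i
      fin_cases i <;> rfl
    refine (congrArg ((Ω j).inChart e (e q)) h1).trans ?_
    refine ((hR _ hq.2).2 j _ _).symm.trans ((stdPolyForm_apply j (e.trans R q) _ _).symm.trans ?_)
    refine congrArg (stdPolyForm n s j (e.trans R q)) (funext fun i => ?_)
    change _ = mfderiv 𝓘(ℝ, E) 𝓘(ℝ, PolyCoord n s) (e.trans R) q (v i)
    rw [(hdΦ q hq.1 hq.2).mfderiv]
    fin_cases i <;> rfl
  · refine ContinuousLinearMap.ext fun v => (hcoord (polyX n s i) v).trans ?_
    exact (congrArg (polyX n s i) (hdF0 _)).trans (congrArg (φ i) (hD v))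
  · refine ContinuousLinearMap.ext fun v => (hcoord (polyY n s j i) v).trans ?_
    exact (congrArg (polyY n s j i) (hdF0 _)).trans (congrArg (ψ j i) (hD v))

end NormalFormChart

theorem mainTheorem5 {E : Type*} [NormedAddCommGroup E] [NormedSpace ℝ E] [FiniteDimensional ℝ E]
    {M : Type*} [TopologicalSpace M] [ChartedSpace E M] [IsManifold 𝓘(ℝ, E) ∞ M]
    {n s : ℕ} (hs : 1 ≤ s) (Ω : Fin s → DiffForm E M 2)
    (hΩ : IsPolysymplecticManifold n Ω) (p : M) :
    (∃ Φ : OpenPartialHomeomorph M (PolyCoord n s), IsPolysymplecticChartAt Ω p Φ) ∧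
    ∀ (φ : Fin n → TangentSpace 𝓘(ℝ, E) p →L[ℝ] ℝ)
      (ψ : Fin s → Fin n → TangentSpace 𝓘(ℝ, E) p →L[ℝ] ℝ),
      (∀ j, Ω j p = ∑ i, covectorWedge (φ i) (ψ j i)) →
      ∃ Φ : OpenPartialHomeomorph M (PolyCoord n s), IsPolysymplecticChartAt Ω p Φ ∧
        (∀ i, mfderiv 𝓘(ℝ, E) 𝓘(ℝ, ℝ) (fun q => (Φ q).1 i) p = φ i) ∧
        (∀ j i, mfderiv 𝓘(ℝ, E) 𝓘(ℝ, ℝ) (fun q => (Φ q).2 j i) p = ψ j i) := by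
  refine ⟨?_, hΩ.exists_chart hs p⟩
  obtain ⟨φ, ψ, hf⟩ := (hΩ.pointwise p).exists_frame hs
  let c : (E →ₗ[ℝ] ℝ) → E →L[ℝ] ℝ := fun a => LinearMap.toContinuousLinearMap a
  obtain ⟨Φ, hΦ, -⟩ := hΩ.exists_chart hs p (fun i => c (φ i)) (fun j i => c (ψ j i)) fun j => by
      refine ContinuousAlternatingMap.ext fun v => ?_
      have hv : v = ![v 0, v 1] := by
        ext i
        fin_cases i <;> rfl
      rw [hv]
      refine (hf j (v 0) (v 1)).trans (Eq.symm ?_)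
      exact (ContinuousAlternatingMap.sum_apply _ _).trans
        (Finset.sum_congr rfl fun i _ => covectorWedge_apply _ _ _ _)
  exact ⟨Φ, hΦ⟩
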